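/- For integers $1\le k\le n$ let $L_k(n)\subseteq[n]^k$ be the set of words of length $k$ over $[n]$ whose symbols are all distinct. An NFA $M$ over the alphabet $[n]$ has one start state, a set of accepting states, and transitions each labelled by one symbol of $[n]$; its size is the number of its states plus the number of its transitions, and it is acyclic if it has no directed cycle. In the problem MIN-WT SIMPLE $(s,t)$-$k$-PATH one is given a directed graph $G$ on $[n]$ with integer edge weights (as adjacency and weight matrices), vertices $s,t$ and the number $k$, and has to determine whether $G$ has a simple path with exactly $k$ vertices that begins in $s$ and ends in $t$, and if so, to return such a path of minimal weight. Running times refer to a random access machine with words of $w$ bits, where $w$ is at least the number of binary digits of $\mathrm{size}(M)$; operations on numbers of $O(w)$ bits take constant time, and longer numbers are charged for the number of words that they occupy (multiplication and division as in the schoolbook method). Let $P$ be a program that is given $n$ and $k$. (1) There is a program $A$ such that for every constant $C$ there is a constant $D$ with the following property. For all integers $1\le k\le n$, if $P$ on input $(n,k)$ constructs, in time at most $C\cdot\sigma$, an NFA $M$ of size $\sigma$ with $L(M)=L_k(n)$, then $A$ solves MIN-WT SIMPLE $(s,t)$-$k$-PATH on all graphs with $n$ vertices and non-negative integer weights of size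 at most $W$ $(W\ge 2)$ in time at most $D\cdot \sigma\cdot\log \sigma\cdot n^2\cdot\log W$. (2) There is a program $A$ such that for every constant $C$ there is a constant $D$ with the following property. For all integers $1\le k\le n$, if $P$ on input $(n,k)$ constructs, in time at most $C\cdot\sigma$, an acyclic NFA $M$ of size $\sigma$ with $L(M)=L_k(n)$, then $A$ solves MIN-WT SIMPLE $(s,t)$-$k$-PATH on all graphs with $n$ vertices and integer weights in the range $[-W,W]$ $(W\ge 2)$ in time at most $D\cdot \sigma\cdot n^2\cdot\log W$. -/

import Mathlib

/-! ## A random access machine with words of `w` bits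

The machine has registers and memory banks (arrays), all holding integers.  An integer occupies as
many words of `w` bits as its binary expansion needs, and an instruction is charged for the words
that it handles: the operations on numbers of `O(w)` bits (in particular on indices and addresses)
take constant time, whereas long numbers are charged for their length. -/

namespace WordRAM

/-- The number of words of `w` bits that are occupied by the integer `x`, up to rounding. -/
def len (w : ℕ) (x : ℤ) : ℕ := Nat.size x.natAbs / w + 1

/-- Contents of the registers, `reg r`, and of the memory banks, `mem b a` (bank, address). -/
structure Store where
  reg : ℕ → ℤ
  mem : ℕ → ℤ → ℤ

/-- `σ` with the value `x` written into the register `r`. -/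
def Store.setReg (σ : Store) (r : ℕ) (x : ℤ) : Store :=
  { σ with reg := Function.update σ.reg r x }

/-- `σ` with the value `x` written into the cell `a` of the bank `b`. -/
def Store.setMem (σ : Store) (b : ℕ) (a x : ℤ) : Store :=
  { σ with mem := Function.update σ.mem b (Function.update (σ.mem b) a x) }

/-- The operations of the arithmetic unit. -/
inductive Op where
  | add | sub | mul | div | and | or | xor | shl | shr

/-- The value of an operation (`div` is integer division, with value `0` for the divisor `0`). -/
def Op.eval : Op → ℤ → ℤ → ℤ
  | add, x, y => x + y
  | sub, x, y => x - y
  | mul, x, y => x * y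
  | div, x, y => x / y
  | and, x, y => Int.land x y
  | or, x, y => Int.lor x y
  | xor, x, y => Int.xor x y
  | shl, x, y => x * 2 ^ y.toNat
  | shr, x, y => x / 2 ^ y.toNat

/-- The cost of an operation: linear in the number of words of the operands and the result,
except for multiplication and division, which are charged as in the schoolbook method. -/
def Op.cost (w : ℕ) (op : Op) (x y : ℤ) : ℕ :=
  match op with
  | mul => len w x * len w y
  | div => len w x * len w y
  | _ => len w x + len w y + len w (op.eval x y)

/-- Programs. -/
inductive Cmd where
  /-- do nothing -/
  | skip
  /-- `r := c` -/
  | const (r : ℕ) (c : ℤ)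
  /-- `r := x op y`, for registers `x` and `y` -/
  | arith (op : Op) (r x y : ℕ)
  /-- `r := b[a]`, for a bank `b` and a register `a` that holds the address -/
  | load (r b a : ℕ)
  /-- `b[a] := r`, for a bank `b` and a register `a` that holds the address -/
  | store (b a r : ℕ)
  /-- `c; d` -/
  | seq (c d : Cmd)
  /-- if the register `r` is positive then `c` else `d` -/
  | branch (r : ℕ) (c d : Cmd)
  /-- while the register `r` is positive do `c` -/
  | loop (r : ℕ) (c : Cmd)

/-- `Exec w c σ τ t`: on a machine with words of `w` bits, the program `c` started in `σ` halts
in `τ`, after exactly `t` time units. -/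
inductive Exec (w : ℕ) : Cmd → Store → Store → ℕ → Prop where
  | skip (σ : Store) : Exec w Cmd.skip σ σ 1
  | const (σ : Store) (r : ℕ) (c : ℤ) :
      Exec w (Cmd.const r c) σ (σ.setReg r c) (len w c)
  | arith (σ : Store) (op : Op) (r x y : ℕ) :
      Exec w (Cmd.arith op r x y) σ (σ.setReg r (op.eval (σ.reg x) (σ.reg y)))
        (op.cost w (σ.reg x) (σ.reg y))
  | load (σ : Store) (r b a : ℕ) :
      Exec w (Cmd.load r b a) σ (σ.setReg r (σ.mem b (σ.reg a)))
        (len w (σ.reg a) + len w (σ.mem b (σ.reg a)))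
  | store (σ : Store) (b a r : ℕ) :
      Exec w (Cmd.store b a r) σ (σ.setMem b (σ.reg a) (σ.reg r))
        (len w (σ.reg a) + len w (σ.reg r))
  | seq {c d : Cmd} {σ τ υ : Store} {t t' : ℕ} (h : Exec w c σ τ t) (h' : Exec w d τ υ t') :
      Exec w (Cmd.seq c d) σ υ (t + t')
  | branch_pos {r : ℕ} {c d : Cmd} {σ τ : Store} {t : ℕ} (hr : 0 < σ.reg r)
      (h : Exec w c σ τ t) : Exec w (Cmd.branch r c d) σ τ (len w (σ.reg r) + t)
  | branch_nonpos {r : ℕ} {c d : Cmd} {σ τ : Store} {t : ℕ} (hr : σ.reg r ≤ 0)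
      (h : Exec w d σ τ t) : Exec w (Cmd.branch r c d) σ τ (len w (σ.reg r) + t)
  | loop_pos {r : ℕ} {c : Cmd} {σ τ υ : Store} {t t' : ℕ} (hr : 0 < σ.reg r)
      (h : Exec w c σ τ t) (h' : Exec w (Cmd.loop r c) τ υ t') :
      Exec w (Cmd.loop r c) σ υ (len w (σ.reg r) + t + t')
  | loop_nonpos {r : ℕ} {c : Cmd} {σ : Store} (hr : σ.reg r ≤ 0) :
      Exec w (Cmd.loop r c) σ σ (len w (σ.reg r))

end WordRAM

/-! ## Automata -/

namespace KPath

open WordRAM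

/-- `L_k(n)`: the words of length `k` over `[n]` whose symbols are all distinct. -/
def distinctWords (n k : ℕ) : Language (Fin n) :=
  {x : List (Fin n) | x.length = k ∧ x.Nodup}

/-- The transitions (source, label, target) of an automaton. -/
def transitions {α σ : Type*} (M : NFA α σ) : Set (σ × α × σ) :=
  {e | e.2.2 ∈ M.step e.1 e.2.1}

/-- The size of an automaton: the number of states plus the number of transitions. -/
noncomputable def autSize {α σ : Type*} (M : NFA α σ) : ℕ :=
  Nat.card σ + (transitions M).ncard

/-- The automaton has no directed cycle (loops included). -/
def IsAcyclic {α σ : Type*} (M : NFA α σ) : Prop :=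
  ∀ q, ¬ Relation.TransGen (fun p r => ∃ a, r ∈ M.step p a) q q

open Classical in
/-- The store holds the automaton `M`, which has a single start state: registers 0, 1, 2 hold the
number of states, the number of transitions and the start state; banks 0, 1, 2 list the sources,
the labels and the targets of the transitions, each transition once, in any order; bank 3 marks the
accepting states. -/
def Holds {n m : ℕ} (τ : Store) (M : NFA (Fin n) (Fin m)) : Prop :=
  ∃ (q₀ : Fin m) (d : ℕ) (e : Fin d ≃ transitions M),
    M.start = {q₀} ∧
    τ.reg 0 = m ∧ τ.reg 1 = d ∧ τ.reg 2 = (q₀ : ℕ) ∧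
    (∀ i : Fin d,
      τ.mem 0 (i : ℕ) = ((e i).1.1 : ℕ) ∧
      τ.mem 1 (i : ℕ) = ((e i).1.2.1 : ℕ) ∧
      τ.mem 2 (i : ℕ) = ((e i).1.2.2 : ℕ)) ∧
    ∀ q : Fin m, τ.mem 3 (q : ℕ) = if q ∈ M.accept then 1 else 0

/-- The input `(n, k)`: in the registers 0 and 1, everything else being 0. -/
def paramInput (n k : ℕ) : Store where
  reg i := match i with
    | 0 => n
    | 1 => k
    | _ => 0
  mem _ _ := 0

/-- With words of `w` bits and input `(n, k)`, the program `P` constructs `M` in time at most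
`T`. -/
def ConstructsWithin {n m : ℕ} (w : ℕ) (P : Cmd) (k : ℕ) (M : NFA (Fin n) (Fin m)) (T : ℝ) :
    Prop :=
  ∃ (τ : Store) (t : ℕ), Exec w P (paramInput n k) τ t ∧ Holds τ M ∧ (t : ℝ) ≤ T

/-! ## Paths -/

/-- `p = v₁ → … → v_k` is a simple path with `k` vertices in `G` from `a` to `b`. -/
def IsSimplePath {V : Type*} (G : Digraph V) (k : ℕ) (a b : V) (p : List V) : Prop :=
  p.length = k ∧ p.Nodup ∧ p.IsChain G.Adj ∧ p.head? = some a ∧ p.getLast? = some b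

/-- The sum of the weights of the edges of a path. -/
def pathWeight {V : Type*} (wt : V → V → ℤ) : List V → ℤ
  | u :: v :: p => wt u v + pathWeight wt (v :: p)
  | _ => 0

/-- `p` is a simple path with `k` vertices from `a` to `b`, of minimal weight among these. -/
def IsMinSimplePath {V : Type*} (G : Digraph V) (wt : V → V → ℤ) (k : ℕ) (a b : V)
    (p : List V) : Prop :=
  IsSimplePath G k a b p ∧ ∀ p', IsSimplePath G k a b p' → pathWeight wt p ≤ pathWeight wt p'

open Classical in
/-- The input of the path problem: `n`, `k` and the vertices `a`, `b` in the registers 0 to 3, the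
adjacency matrix in bank 0 and the weights of the edges in bank 1, both row by row, everything else
being 0. -/
noncomputable def pathInput {n : ℕ} (G : Digraph (Fin n)) (wt : Fin n → Fin n → ℤ) (k : ℕ)
    (a b : Fin n) : Store where
  reg i := match i with
    | 0 => n
    | 1 => k
    | 2 => (a : ℕ)
    | 3 => (b : ℕ)
    | _ => 0
  mem i x := match i with
    | 0 => ∑ u : Fin n, ∑ v : Fin n,
        if x = (u : ℕ) * (n : ℤ) + (v : ℕ) ∧ G.Adj u v then 1 else 0
    | 1 => ∑ u : Fin n, ∑ v : Fin n,
        if x = (u : ℕ) * (n : ℤ) + (v : ℕ) ∧ G.Adj u v then wt u v else 0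
    | _ => 0

/-- The store holds a correct answer to the path problem: register 0 says whether a path exists,
and if so, bank 0 lists the vertices of one of minimal weight. -/
def IsAnswer {n : ℕ} (G : Digraph (Fin n)) (wt : Fin n → Fin n → ℤ) (k : ℕ) (a b : Fin n)
    (τ : Store) : Prop :=
  (τ.reg 0 = 1 ∧ ∃ p : List (Fin n), IsMinSimplePath G wt k a b p ∧
      ∀ i : Fin p.length, τ.mem 0 (i : ℕ) = (p.get i : ℕ)) ∨
    (τ.reg 0 = 0 ∧ ¬ ∃ p, IsSimplePath G k a b p)

/-- With words of `w` bits, the program `A` solves the instance of the path problem in time at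
most `T`. -/
def SolvesWithin {n : ℕ} (w : ℕ) (A : Cmd) (G : Digraph (Fin n)) (wt : Fin n → Fin n → ℤ)
    (k : ℕ) (a b : Fin n) (T : ℝ) : Prop :=
  ∃ (τ : Store) (t : ℕ), Exec w A (pathInput G wt k a b) τ t ∧ IsAnswer G wt k a b τ ∧
    (t : ℝ) ≤ T

end KPath

/-! The algorithm is dynamic programming on the product of `G` with the automaton, unrolled into `k`
layers. An entry `(i, q, v)` stands for the walks with `i + 1` vertices from `a` to `v` whose first
`i` vertices lead the automaton from its start state to `q`. An edge from `(i, q, v)` to `(i + 1,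
q', u)` needs a transition `(q, v, q')` and an edge `(v, u)` of `G`. A walk that ends in an entry
`(k - 1, q, b)` and is completed by a transition reading `b` into an accepting state spells an
accepted word. Since the language is `L_k(n)`, the accepted walks from `a` to `b` are exactly the
simple paths with `k` vertices, so a shortest walk in the layered graph is a minimal simple path.

The layered graph is acyclic whatever the automaton looks like. Processing its layers in order
therefore relaxes each edge only once, needs no priority queue and tolerates negative weights. There
are at most `k * d * n` relaxations for `d` transitions, hence at most `σ * n ^ 2`. All numbers
involved fit into a constant number of words plus the bits of `W`, so an instruction costs `O(log
W)`. One program proves both claims, because `log σ` is bounded below by a positive constant.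

On the machine side, `Exec.shift` lets `P` run without disturbing the input. The correctness of the
tables is carried by `Layers.update`, `Relaxed.update`, `Layers.exists_final` and
`Layers.isMinSimplePath`. Loop invariants connect them to the program, and `solvesWithin_solveCmd`
collects the costs. -/

namespace WordRAM

/-! ### Relocating a program within the store -/

@[simp] lemma Store.reg_setReg (σ : Store) (r : ℕ) (x : ℤ) (r' : ℕ) :
    (σ.setReg r x).reg r' = if r' = r then x else σ.reg r' := by
  simp [Store.setReg, Function.update_apply]

@[simp] lemma Store.mem_setReg (σ : Store) (r : ℕ) (x : ℤ) : (σ.setReg r x).mem = σ.mem := rfl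

@[simp] lemma Store.reg_setMem (σ : Store) (b : ℕ) (a x : ℤ) : (σ.setMem b a x).reg = σ.reg := rfl

@[simp] lemma Store.mem_setMem (σ : Store) (b : ℕ) (a x : ℤ) (b' : ℕ) :
    (σ.setMem b a x).mem b' = if b' = b then Function.update (σ.mem b) a x else σ.mem b' := by
  simp [Store.setMem, Function.update_apply]

/-- The program with all registers shifted by `R` and all banks shifted by `B`. -/
def Cmd.shift (R B : ℕ) : Cmd → Cmd
  | .skip => .skip
  | .const r c => .const (r + R) c
  | .arith op r x y => .arith op (r + R) (x + R) (y + R)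
  | .load r b a => .load (r + R) (b + B) (a + R)
  | .store b a r => .store (b + B) (a + R) (r + R)
  | .seq c d => .seq (c.shift R B) (d.shift R B)
  | .branch r c d => .branch (r + R) (c.shift R B) (d.shift R B)
  | .loop r c => .loop (r + R) (c.shift R B)

/-- The part of the store that a program shifted by `R` and `B` can access. -/
def Store.view (R B : ℕ) (σ : Store) : Store where
  reg r := σ.reg (r + R)
  mem b := σ.mem (b + B)

/-- `τ` agrees with `σ` on the registers below `R` and on the banks below `B`. -/
def Store.SameBelow (R B : ℕ) (σ τ : Store) : Prop :=
  (∀ r < R, τ.reg r = σ.reg r) ∧ ∀ b < B, τ.mem b = σ.mem b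

lemma Store.SameBelow.refl (R B : ℕ) (σ : Store) : σ.SameBelow R B σ :=
  ⟨fun _ _ => rfl, fun _ _ => rfl⟩

lemma Store.SameBelow.trans {R B : ℕ} {σ τ υ : Store} (h : σ.SameBelow R B τ)
    (h' : τ.SameBelow R B υ) : σ.SameBelow R B υ :=
  ⟨fun r hr => (h'.1 r hr).trans (h.1 r hr), fun b hb => (h'.2 b hb).trans (h.2 b hb)⟩

lemma Store.sameBelow_setReg (R B : ℕ) (σ : Store) (r : ℕ) (x : ℤ) :
    σ.SameBelow R B (σ.setReg (r + R) x) :=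
  ⟨fun r' hr => by simp; omega, fun _ _ => rfl⟩

lemma Store.sameBelow_setMem (R B : ℕ) (σ : Store) (b : ℕ) (a x : ℤ) :
    σ.SameBelow R B (σ.setMem (b + B) a x) :=
  ⟨fun _ _ => rfl, fun b' hb => by rw [Store.mem_setMem, if_neg (by omega)]⟩

lemma Store.view_setReg (R B : ℕ) (σ : Store) (r : ℕ) (x : ℤ) :
    (σ.setReg (r + R) x).view R B = (σ.view R B).setReg r x := by
  simp only [Store.view, Store.setReg, Store.mk.injEq, and_true]
  funext r'
  simp [Function.update_apply]

lemma Store.view_setMem (R B : ℕ) (σ : Store) (b : ℕ) (a x : ℤ) :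
    (σ.setMem (b + B) a x).view R B = (σ.view R B).setMem b a x := by
  simp only [Store.view, Store.setMem, Store.mk.injEq, true_and]
  funext b'
  simp [Function.update_apply]

/-- Costs depend only on the values handled and not on where they are stored, so relocation
preserves the running time exactly. This makes `P` usable as a subroutine that leaves the path
instance intact. -/
lemma Exec.shift {w : ℕ} (R B : ℕ) {c : Cmd} {σ τ : Store} {t : ℕ} (h : Exec w c σ τ t) :
    ∀ σ' : Store, σ'.view R B = σ →
      ∃ τ', Exec w (c.shift R B) σ' τ' t ∧ τ'.view R B = τ ∧ σ'.SameBelow R B τ' := by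
  induction h with
  | skip σ => exact fun σ' h => ⟨σ', .skip _, h, .refl ..⟩
  | const σ r c =>
    rintro σ' rfl
    exact ⟨_, .const .., Store.view_setReg .., Store.sameBelow_setReg ..⟩
  | arith σ op r x y =>
    rintro σ' rfl
    exact ⟨_, .arith .., Store.view_setReg .., Store.sameBelow_setReg ..⟩
  | load σ r b a =>
    rintro σ' rfl
    exact ⟨_, .load .., Store.view_setReg .., Store.sameBelow_setReg ..⟩
  | store σ b a r =>
    rintro σ' rfl
    exact ⟨_, .store .., Store.view_setMem .., Store.sameBelow_setMem ..⟩
  | seq _ _ ih ih' =>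
    intro σ' h
    obtain ⟨τ', e, v, s⟩ := ih σ' h
    obtain ⟨υ', e', v', s'⟩ := ih' τ' v
    exact ⟨υ', .seq e e', v', s.trans s'⟩
  | branch_pos hr _ ih =>
    rintro σ' rfl
    obtain ⟨τ', e, v, s⟩ := ih σ' rfl
    exact ⟨τ', .branch_pos hr e, v, s⟩
  | branch_nonpos hr _ ih =>
    rintro σ' rfl
    obtain ⟨τ', e, v, s⟩ := ih σ' rfl
    exact ⟨τ', .branch_nonpos hr e, v, s⟩
  | loop_pos hr _ _ ih ih' =>
    rintro σ' rfl
    obtain ⟨τ', e, v, s⟩ := ih σ' rfl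
    obtain ⟨υ', e', v', s'⟩ := ih' τ' v
    exact ⟨υ', .loop_pos hr e e', v', s.trans s'⟩
  | loop_nonpos hr =>
    rintro σ' rfl
    exact ⟨σ', .loop_nonpos hr, rfl, .refl ..⟩

/-! ### Time-bounded correctness of programs -/

/-- Started in `σ`, the program `c` halts within time `T` in a store that satisfies `Q`. -/
def Within (w : ℕ) (c : Cmd) (σ : Store) (T : ℕ) (Q : Store → Prop) : Prop :=
  ∃ τ t, Exec w c σ τ t ∧ t ≤ T ∧ Q τ

namespace Within

variable {w : ℕ} {c d : Cmd} {σ : Store} {T T' : ℕ} {Q Q' : Store → Prop}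

lemma mono (h : Within w c σ T Q) (hT : T ≤ T') (hQ : ∀ τ, Q τ → Q' τ) : Within w c σ T' Q' :=
  let ⟨τ, t, e, ht, q⟩ := h
  ⟨τ, t, e, ht.trans hT, hQ τ q⟩

lemma le (h : Within w c σ T Q) (hT : T ≤ T' := by omega) : Within w c σ T' Q :=
  h.mono hT fun _ h => h

lemma seq (h : Within w c σ T' (fun τ => Within w d τ (T - T') Q)) (hT : T' ≤ T := by omega) :
    Within w (.seq c d) σ T Q :=
  let ⟨_, _, e, ht, υ, _, e', ht', q⟩ := h
  ⟨υ, _, .seq e e', by omega, q⟩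

lemma skip {K : ℕ} (hK : 1 ≤ K) (h : Q σ) : Within w .skip σ K Q :=
  ⟨σ, 1, .skip σ, hK, h⟩

lemma branch {K r : ℕ} (hr : len w (σ.reg r) ≤ K) (hK : K ≤ T)
    (h : 0 < σ.reg r → Within w c σ (T - K) Q) (h' : σ.reg r ≤ 0 → Within w d σ (T - K) Q) :
    Within w (.branch r c d) σ T Q := by
  rcases lt_or_ge 0 (σ.reg r) with hp | hp
  · obtain ⟨τ, t, e, ht, q⟩ := h hp
    exact ⟨τ, _, .branch_pos hp e, by omega, q⟩
  · obtain ⟨τ, t, e, ht, q⟩ := h' hp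
    exact ⟨τ, _, .branch_nonpos hp e, by omega, q⟩

/-- Each of the `N` iterations pays for a test and the body. The final failing test accounts for the
summand `1`. -/
lemma countdown {K r : ℕ} (I : ℕ → Store → Prop) (hreg : ∀ j σ, I j σ → σ.reg r = j)
    (hbody : ∀ j σ, I (j + 1) σ → Within w c σ T (I j)) :
    ∀ (N : ℕ) (σ : Store), (∀ j : ℕ, j ≤ N → len w j ≤ K) → I N σ →
      Within w (.loop r c) σ ((N + 1) * (K + T)) (I 0)
  | 0, σ, hlen, h => by
    have e := hreg _ _ h
    refine ⟨σ, _, .loop_nonpos (by simp [e]), ?_, h⟩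
    rw [e]
    have := hlen 0 le_rfl
    omega
  | N + 1, σ, hlen, h => by
    have e := hreg _ _ h
    obtain ⟨τ, t, ex, ht, q⟩ := hbody _ _ h
    obtain ⟨υ, t', ex', ht', q'⟩ :=
      countdown I hreg hbody N τ (fun j hj => hlen j (by omega)) q
    refine ⟨υ, _, .loop_pos (by rw [e]; positivity) ex ex', ?_, q'⟩
    rw [e]
    have := hlen _ le_rfl
    calc _ ≤ K + T + (N + 1) * (K + T) := by omega
      _ = _ := by ring

end Within

/-- Since `w ≥ 1`, the `s` excess bits fill at most `s` words. This crude count is what turns the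
bits of `W` into a factor `log W`. -/
lemma len_le {w : ℕ} (hw : 1 ≤ w) (c s : ℕ) {x : ℤ} (hx : x.natAbs < 2 ^ (c * w + s)) :
    len w x ≤ c + s + 1 := by
  have h1 : Nat.size x.natAbs ≤ c * w + s := Nat.size_le.2 hx
  have h2 : Nat.size x.natAbs / w ≤ c + s := by
    refine Nat.div_le_of_le_mul ?_
    nlinarith
  unfold len
  omega

end WordRAM

/-! ### Acceptance from a state, and addresses -/

namespace KPath
open WordRAM

/-- `x` is accepted by `M` from the state `q`. -/
def AcceptsFrom {α σ : Type*} (M : NFA α σ) : σ → List α → Prop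
  | q, [] => q ∈ M.accept
  | q, a :: x => ∃ q' ∈ M.step q a, AcceptsFrom M q' x

/-- `NFA.evalFrom` moves sets of states forward, so the induction has to run over an arbitrary set
`S`. -/
lemma exists_acceptsFrom_iff {α σ : Type*} (M : NFA α σ) (x : List α) (S : Set σ) :
    (∃ q ∈ S, AcceptsFrom M q x) ↔ ∃ q ∈ M.accept, q ∈ M.evalFrom S x := by
  induction x generalizing S with
  | nil => simp [AcceptsFrom, and_comm]
  | cons a x ih =>
    rw [NFA.evalFrom_cons, ← ih]
    simp only [AcceptsFrom, NFA.mem_stepSet]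
    constructor
    · rintro ⟨q, hq, q', h, h'⟩
      exact ⟨q', ⟨q, hq, h⟩, h'⟩
    · rintro ⟨q', ⟨q, hq, h⟩, h'⟩
      exact ⟨q, hq, q', h, h'⟩

lemma mem_accepts_iff_acceptsFrom {α σ : Type*} {M : NFA α σ} {q₀ : σ} (h : M.start = {q₀})
    (x : List α) : x ∈ M.accepts ↔ AcceptsFrom M q₀ x := by
  have := exists_acceptsFrom_iff M x M.start
  rw [h] at this
  simp only [Set.mem_singleton_iff, exists_eq_left] at this
  rw [this, ← h]
  rfl

/-- Uniqueness of quotient and remainder. Applied repeatedly, it shows that distinct table or matrix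
entries have distinct addresses. -/
lemma add_mul_inj {n : ℕ} {x x' : ℤ} {v v' : Fin n}
    (h : x * n + (v : ℕ) = x' * n + (v' : ℕ)) : x = x' ∧ v = v' := by
  have hv := v.2
  have hv' := v'.2
  have hx : x = x' := by
    have hn : (0 : ℤ) < n := by omega
    rcases lt_trichotomy x x' with hlt | heq | hlt
    · nlinarith
    · exact heq
    · nlinarith
  subst hx
  exact ⟨rfl, Fin.ext (by omega)⟩

/-- The data of an instance of the path problem, together with an automaton whose transitions are
listed by `e`. -/
structure Setup (n m : ℕ) where
  G : Digraph (Fin n)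
  wt : Fin n → Fin n → ℤ
  k : ℕ
  a : Fin n
  b : Fin n
  M : NFA (Fin n) (Fin m)
  q₀ : Fin m
  d : ℕ
  e : Fin d → Fin m × Fin n × Fin m
  W : ℕ
  w : ℕ
  one_le_k : 1 ≤ k
  k_le : k ≤ n
  one_le_W : 1 ≤ W
  one_le_w : 1 ≤ w
  n_lt : n < 2 ^ w
  m_lt : m < 2 ^ w
  d_lt : d < 2 ^ w
  mem_e : ∀ i, (e i).2.2 ∈ M.step (e i).1 (e i).2.1
  exists_e : ∀ q v q', q' ∈ M.step q v → ∃ i, e i = (q, v, q')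
  abs_wt : ∀ u v, G.Adj u v → |wt u v| ≤ W

/-! ### The layered tables and shortest accepted walks -/

namespace Setup

variable {n m : ℕ} (S : Setup n m)

/-- The address of the entry of the tables for the layer `i`, the state `q` and the vertex `v`. -/
def adr (_ : Setup n m) (i : ℕ) (q : Fin m) (v : Fin n) : ℤ :=
  ((i : ℤ) * m + (q : ℕ)) * n + (v : ℕ)

lemma adr_inj {i i' : ℕ} {q q' : Fin m} {v v' : Fin n} :
    S.adr i q v = S.adr i' q' v' ↔ i = i' ∧ q = q' ∧ v = v' := by
  constructor
  · intro h
    obtain ⟨h₁, hv⟩ := add_mul_inj h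
    obtain ⟨h₂, hq⟩ := add_mul_inj h₁
    exact ⟨by exact_mod_cast h₂, hq, hv⟩
  · rintro ⟨rfl, rfl, rfl⟩
    rfl

/-- The tables: entry `(i, q, v)` is marked if there is a walk with `i + 1` vertices from `a` to
`v` whose first `i` vertices lead the automaton to `q`; then `dist` is the weight of such a walk
and `pq`, `pv` hold the preceding entry. -/
structure Sound (mark dist pq pv : ℤ → ℤ) : Prop where
  bin : ∀ i q v, mark (S.adr i q v) = 0 ∨ mark (S.adr i q v) = 1
  start_mark : mark (S.adr 0 S.q₀ S.a) = 1
  start_dist : dist (S.adr 0 S.q₀ S.a) = 0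
  start_unique : ∀ q v, mark (S.adr 0 q v) = 1 → q = S.q₀ ∧ v = S.a
  pred : ∀ i q' u, mark (S.adr (i + 1) q' u) = 1 → ∃ (q : Fin m) (v : Fin n),
    pq (S.adr (i + 1) q' u) = (q : ℕ) ∧ pv (S.adr (i + 1) q' u) = (v : ℕ) ∧
    mark (S.adr i q v) = 1 ∧ q' ∈ S.M.step q v ∧ S.G.Adj v u ∧
    dist (S.adr (i + 1) q' u) = dist (S.adr i q v) + S.wt v u

/-- The edge from `(i, q, v)` to `(i + 1, q', u)` has been relaxed. -/
def Relaxed (mark dist : ℤ → ℤ) (i : ℕ) (q : Fin m) (v : Fin n) (q' : Fin m) (u : Fin n) : Prop :=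
  mark (S.adr i q v) = 1 → S.G.Adj v u → mark (S.adr (i + 1) q' u) = 1 ∧
    dist (S.adr (i + 1) q' u) ≤ dist (S.adr i q v) + S.wt v u

/-- The layers below `i` have been processed, and nothing has been entered beyond layer `l`. -/
structure Layers (mark dist pq pv : ℤ → ℤ) (i l : ℕ) : Prop extends
    S.Sound mark dist pq pv where
  relaxed : ∀ j < i, ∀ q v q' u, q' ∈ S.M.step q v → S.Relaxed mark dist j q v q' u
  fresh : ∀ j q v, l < j → mark (S.adr j q v) = 0

variable {S} {mark dist pq pv : ℤ → ℤ}

/-- The distance of an entry in layer `i` is the weight of a walk with `i` edges, as following the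
predecessors shows. -/
lemma Sound.abs_dist_le (h : S.Sound mark dist pq pv) (i : ℕ) (q : Fin m) (v : Fin n)
    (hm : mark (S.adr i q v) = 1) : |dist (S.adr i q v)| ≤ i * S.W := by
  induction i generalizing q v with
  | zero =>
    obtain ⟨rfl, rfl⟩ := h.start_unique q v hm
    simp [h.start_dist]
  | succ i ih =>
    obtain ⟨q₁, v₁, -, -, h₁, -, h₂, h₃⟩ := h.pred i q v hm
    rw [h₃]
    have := ih _ _ h₁
    have := S.abs_wt _ _ h₂
    have := abs_add_le (dist (S.adr i q₁ v₁)) (S.wt v₁ v)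
    push_cast
    linarith

/-- Only layer `i + 1` is written, while the predecessors of all marked entries lie in layers up to
`i` because nothing is marked beyond layer `i + 1`. So the equations in `pred` stay exact, and the
edges leaving earlier layers stay relaxed. -/
lemma Layers.update {i : ℕ} (h : S.Layers mark dist pq pv i (i + 1)) {q q' : Fin m} {v u : Fin n}
    (hm : mark (S.adr i q v) = 1) (hq : q' ∈ S.M.step q v) (hu : S.G.Adj v u) {x : ℤ}
    (hx : x = dist (S.adr i q v) + S.wt v u) :
    S.Layers (Function.update mark (S.adr (i + 1) q' u) 1)
      (Function.update dist (S.adr (i + 1) q' u) x)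
      (Function.update pq (S.adr (i + 1) q' u) (q : ℕ))
      (Function.update pv (S.adr (i + 1) q' u) (v : ℕ)) i (i + 1) := by
  constructor
  · constructor
    · intro j q₁ v₁
      rw [Function.update_apply]
      split_ifs
      · exact .inr rfl
      · exact h.bin ..
    · simp [Function.update_apply, h.start_mark]
    · simp [S.adr_inj, h.start_dist]
    · intro q₁ v₁
      simpa [Function.update_apply, S.adr_inj] using h.start_unique q₁ v₁
    · intro j q₁ u₁ hm₁
      by_cases he : S.adr (j + 1) q₁ u₁ = S.adr (i + 1) q' u
      · obtain ⟨hj, rfl, rfl⟩ := S.adr_inj.1 he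
        obtain rfl : j = i := by omega
        refine ⟨q, v, ?_⟩
        simp [S.adr_inj, hm, hq, hu, hx]
      · simp only [Function.update_apply, if_neg he] at hm₁ ⊢
        have hj : j ≤ i := by
          by_contra! hj
          rw [h.fresh (j + 1) q₁ u₁ (by omega)] at hm₁
          omega
        obtain ⟨q₂, v₂, h₁, h₂, h₃, h₄, h₅, h₆⟩ := h.pred j q₁ u₁ hm₁
        have he' : S.adr j q₂ v₂ ≠ S.adr (i + 1) q' u := fun h' => by
          have := (S.adr_inj.1 h').1
          omega
        exact ⟨q₂, v₂, h₁, h₂, by rwa [if_neg he'], h₄, h₅, by rwa [if_neg he']⟩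
  · intro j hj q₁ v₁ q₂ u₁ hs hm₁ ha
    have := h.relaxed j hj q₁ v₁ q₂ u₁ hs
    have e₁ : S.adr j q₁ v₁ ≠ S.adr (i + 1) q' u := fun h' => by
      have := (S.adr_inj.1 h').1
      omega
    have e₂ : S.adr (j + 1) q₂ u₁ ≠ S.adr (i + 1) q' u := fun h' => by
      have := (S.adr_inj.1 h').1
      omega
    simp only [Function.update_apply, if_neg e₁, if_neg e₂] at hm₁ ⊢
    exact this hm₁ ha
  · intro j q₁ v₁ hj
    have e₁ : S.adr j q₁ v₁ ≠ S.adr (i + 1) q' u := fun h' => by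
      have := (S.adr_inj.1 h').1
      omega
    rw [Function.update_apply, if_neg e₁, h.fresh j q₁ v₁ hj]

/-- A write never increases the distance of a marked entry, so it cannot spoil an edge that was
relaxed before. -/
lemma Relaxed.update {i : ℕ} {q₁ q₂ q' : Fin m} {v₁ u₁ u : Fin n} {x : ℤ}
    (h : S.Relaxed mark dist i q₁ v₁ q₂ u₁)
    (hx : mark (S.adr (i + 1) q' u) = 1 → x ≤ dist (S.adr (i + 1) q' u)) :
    S.Relaxed (Function.update mark (S.adr (i + 1) q' u) 1)
      (Function.update dist (S.adr (i + 1) q' u) x) i q₁ v₁ q₂ u₁ := by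
  intro hm ha
  have e₁ : S.adr i q₁ v₁ ≠ S.adr (i + 1) q' u := fun h' => by
    have := (S.adr_inj.1 h').1
    omega
  simp only [Function.update_apply, if_neg e₁] at hm ⊢
  obtain ⟨h₁, h₂⟩ := h hm ha
  split_ifs with h'
  · rw [h'] at h₁ h₂
    exact ⟨rfl, (hx h₁).trans h₂⟩
  · exact ⟨h₁, h₂⟩

lemma relaxed_update_self {i : ℕ} {q q' : Fin m} {v u : Fin n} :
    S.Relaxed (Function.update mark (S.adr (i + 1) q' u) 1)
      (Function.update dist (S.adr (i + 1) q' u) (dist (S.adr i q v) + S.wt v u)) i q v q' u := by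
  intro _ _
  simp [S.adr_inj]

/-- The state `q` completes a walk to `b`. -/
def Final (S : Setup n m) (mark : ℤ → ℤ) (q : Fin m) : Prop :=
  mark (S.adr (S.k - 1) q S.b) = 1 ∧ ∃ q' ∈ S.M.step q S.b, q' ∈ S.M.accept

/-- Along an accepted continuation every edge is relaxed, so the distances in the table never exceed
the weight accumulated by the walk. This is the lower bound in the optimality proof. -/
lemma Layers.exists_final {l : ℕ} (h : S.Layers mark dist pq pv (S.k - 1) l) (p : List (Fin n))
    (i : ℕ) (q : Fin m) (v : Fin n) (hm : mark (S.adr i q v) = 1)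
    (hc : (v :: p).IsChain S.G.Adj) (hl : (v :: p).getLast? = some S.b)
    (hi : i + p.length = S.k - 1) (hM : AcceptsFrom S.M q (v :: p)) :
    ∃ q', S.Final mark q' ∧
      dist (S.adr (S.k - 1) q' S.b) ≤ dist (S.adr i q v) + pathWeight S.wt (v :: p) := by
  induction p generalizing i q v with
  | nil =>
    simp only [List.length_nil, add_zero] at hi
    simp only [List.getLast?_singleton, Option.some.injEq] at hl
    subst hl hi
    exact ⟨q, ⟨hm, hM⟩, by simp [pathWeight]⟩
  | cons u p ih =>
    obtain ⟨q₁, hq₁, hM⟩ := hM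
    simp only [List.length_cons] at hi
    rw [List.isChain_cons_cons] at hc
    obtain ⟨h₁, h₂⟩ := h.relaxed i (by omega) q v q₁ u hq₁ hm hc.1
    obtain ⟨q', h₃, h₄⟩ := ih (i + 1) q₁ u h₁ hc.2 (by simpa using hl) (by omega) hM
    refine ⟨q', h₃, h₄.trans ?_⟩
    simp only [pathWeight]
    linarith

/-- The list `p` completes a walk to the entry `(i, q, v)` to an accepted walk to `b`. -/
structure Suffix (S : Setup n m) (dist : ℤ → ℤ) (x : ℤ) (i : ℕ) (q : Fin m) (v : Fin n)
    (p : List (Fin n)) : Prop where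
  length : i + p.length + 1 = S.k
  chain : (v :: p).IsChain S.G.Adj
  last : (v :: p).getLast? = some S.b
  accepts : AcceptsFrom S.M q (v :: p)
  weight : dist (S.adr i q v) + pathWeight S.wt (v :: p) = x

/-- Acceptance makes the reconstructed walk simple with `k` vertices. Conversely, every competing
simple path is accepted, so `Layers.exists_final` compares it with a final entry, whose distance is
at least `x`. -/
lemma Layers.isMinSimplePath {l : ℕ} {x : ℤ} {p : List (Fin n)} {q : Fin m} {v : Fin n}
    (h : S.Layers mark dist pq pv (S.k - 1) l)
    (hL : S.M.accepts = distinctWords n S.k) (hs : S.M.start = {S.q₀})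
    (hx : ∀ q, S.Final mark q → x ≤ dist (S.adr (S.k - 1) q S.b))
    (hm : mark (S.adr 0 q v) = 1) (hp : S.Suffix dist x 0 q v p) :
    IsMinSimplePath S.G S.wt S.k S.a S.b (v :: p) := by
  obtain ⟨rfl, rfl⟩ := h.start_unique q v hm
  have hacc : S.a :: p ∈ distinctWords n S.k := by
    rw [← hL, mem_accepts_iff_acceptsFrom hs]
    exact hp.accepts
  refine ⟨⟨hacc.1, hacc.2, hp.chain, rfl, hp.last⟩, ?_⟩
  rintro p' ⟨h₁, h₂, h₃, h₄, h₅⟩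
  have hacc' : p' ∈ S.M.accepts := hL ▸ ⟨h₁, h₂⟩
  rw [mem_accepts_iff_acceptsFrom hs] at hacc'
  rcases p' with - | ⟨v', p'⟩
  · simp at h₄
  simp only [List.head?_cons, Option.some.injEq] at h₄
  subst h₄
  obtain ⟨q', h₆, h₇⟩ := h.exists_final p' 0 S.q₀ S.a h.start_mark h₃ h₅
    (by simp at h₁; omega) hacc'
  have := hx q' h₆
  have := hp.weight
  rw [h.start_dist] at *
  linarith

lemma Layers.not_exists_isSimplePath {l : ℕ}
    (h : S.Layers mark dist pq pv (S.k - 1) l)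
    (hL : S.M.accepts = distinctWords n S.k) (hs : S.M.start = {S.q₀})
    (hx : ∀ q, ¬ S.Final mark q) : ¬ ∃ p, IsSimplePath S.G S.k S.a S.b p := by
  rintro ⟨p', h₁, h₂, h₃, h₄, h₅⟩
  have hacc' : p' ∈ S.M.accepts := hL ▸ ⟨h₁, h₂⟩
  rw [mem_accepts_iff_acceptsFrom hs] at hacc'
  rcases p' with - | ⟨v', p'⟩
  · simp at h₄
  simp only [List.head?_cons, Option.some.injEq] at h₄
  subst h₄
  obtain ⟨q', h₆, h₇⟩ := h.exists_final p' 0 S.q₀ S.a h.start_mark h₃ h₅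
    (by simp at h₁; omega) hacc'
  exact hx q' h₆

end Setup
end KPath

/-! ### Sizes of numbers and costs of instructions -/

namespace KPath
open WordRAM
namespace Setup

variable {n m : ℕ} (S : Setup n m)

/-- A bound for the cost of every instruction. -/
def K : ℕ := 3 * (4 + Nat.size S.W)

/-- All integers that the program handles are at most that large. -/
def Big (x : ℤ) : Prop := |x| ≤ ((2 ^ (3 * S.w) * S.W : ℕ) : ℤ)

/-- An additive instruction is charged for two operands and a result, hence the factor 3. -/
lemma three_mul_len_le {x : ℤ} (hx : S.Big x) : 3 * len S.w x ≤ S.K := by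
  have : len S.w x ≤ 3 + Nat.size S.W + 1 := by
    refine len_le S.one_le_w 3 (Nat.size S.W) ?_
    rw [Big, Int.abs_eq_natAbs] at hx
    have hx : x.natAbs ≤ 2 ^ (3 * S.w) * S.W := by exact_mod_cast hx
    refine hx.trans_lt ?_
    rw [pow_add]
    exact mul_lt_mul_of_pos_left (Nat.lt_size_self _) (by positivity)
  unfold K
  omega

lemma len_le_K {x : ℤ} (hx : S.Big x) : len S.w x ≤ S.K := by
  have := S.three_mul_len_le hx
  omega

lemma one_le_K : 1 ≤ S.K := by
  unfold K
  omega

lemma big_of_le {x : ℤ} (h₀ : 0 ≤ x) (h : x ≤ 2 ^ (3 * S.w)) : S.Big x := by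
  rw [Big, abs_of_nonneg h₀]
  have : (1 : ℤ) ≤ S.W := by exact_mod_cast S.one_le_W
  push_cast
  nlinarith

lemma big_natCast {x : ℕ} (h : x ≤ 2 ^ S.w) : S.Big x := by
  refine S.big_of_le (by positivity) ?_
  have : x ≤ 2 ^ (3 * S.w) := h.trans (Nat.pow_le_pow_right (by norm_num) (by omega))
  exact_mod_cast this

/-- Distances are at most `k * W` in absolute value. The factor 2 leaves room for the difference of
two of them. -/
lemma big_of_abs_le {x : ℤ} (h : |x| ≤ 2 * (S.k + 1) * S.W) : S.Big x := by
  have h₁ : 2 ≤ 2 ^ S.w := by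
    calc 2 = 2 ^ 1 := rfl
      _ ≤ 2 ^ S.w := Nat.pow_le_pow_right (by norm_num) S.one_le_w
  have h₂ : S.k + 1 ≤ 2 ^ S.w := by
    have := S.k_le
    have := S.n_lt
    omega
  have h₃ : 2 * (S.k + 1) ≤ 2 ^ (3 * S.w) := by
    calc 2 * (S.k + 1) ≤ 2 ^ S.w * 2 ^ S.w := Nat.mul_le_mul h₁ h₂
      _ = 2 ^ (S.w + S.w) := by rw [pow_add]
      _ ≤ _ := Nat.pow_le_pow_right (by norm_num) (by omega)
  refine h.trans ?_
  exact_mod_cast Nat.mul_le_mul_right S.W h₃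

lemma big_zero : S.Big 0 := S.big_natCast (x := 0) (by positivity)

lemma big_one : S.Big 1 := by
  simpa using S.big_natCast (x := 1) Nat.one_le_two_pow

lemma fin_le_pow (v : Fin n) : (v : ℕ) ≤ 2 ^ S.w := (v.2.trans S.n_lt).le

lemma state_le_pow (q : Fin m) : (q : ℕ) ≤ 2 ^ S.w := (q.2.trans S.m_lt).le

lemma nat_le_pow {j : ℕ} (h : j ≤ n) : j ≤ 2 ^ S.w := h.trans S.n_lt.le

lemma layer_le_pow {i : ℕ} (h : i ≤ S.k) : i ≤ 2 ^ S.w := S.nat_le_pow (h.trans S.k_le)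

lemma transition_le_pow {i : ℕ} (h : i ≤ S.d) : i ≤ 2 ^ S.w := h.trans S.d_lt.le

lemma row_lt {i : ℕ} (h : i < S.k) (q : Fin m) : i * m + q < 2 ^ (2 * S.w) := by
  have h₁ : (i + 1) * m ≤ 2 ^ S.w * 2 ^ S.w :=
    Nat.mul_le_mul (S.layer_le_pow h) S.m_lt.le
  rw [← pow_add, ← two_mul] at h₁
  have := q.2
  nlinarith

lemma adr_le {i : ℕ} (h : i < S.k) (q : Fin m) (v : Fin n) :
    (i * m + q) * n + v ≤ 2 ^ (3 * S.w) := by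
  have h₁ : (i * m + q + 1) * n ≤ 2 ^ (2 * S.w) * 2 ^ S.w :=
    Nat.mul_le_mul (S.row_lt h q) S.n_lt.le
  rw [← pow_add, show 2 * S.w + S.w = 3 * S.w by ring] at h₁
  have := v.2
  nlinarith

lemma big_adr {i : ℕ} (h : i < S.k) (q : Fin m) (v : Fin n) : S.Big (S.adr i q v) := by
  refine S.big_of_le (by unfold adr; positivity) ?_
  unfold adr
  exact_mod_cast S.adr_le h q v

/-- The address of the entry of the matrices for the pair `(u, v)`. -/
def pos (_ : Setup n m) (u v : Fin n) : ℤ := (u : ℕ) * (n : ℤ) + (v : ℕ)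

lemma pos_le (u v : Fin n) : u * n + v ≤ 2 ^ (3 * S.w) := by
  have h₁ : (u + 1) * n ≤ 2 ^ S.w * 2 ^ S.w :=
    Nat.mul_le_mul (u.2.trans S.n_lt) S.n_lt.le
  rw [← pow_add] at h₁
  have h₂ : 2 ^ (S.w + S.w) ≤ 2 ^ (3 * S.w) := Nat.pow_le_pow_right (by norm_num) (by omega)
  have := v.2
  nlinarith

lemma big_pos (u v : Fin n) : S.Big (S.pos u v) := by
  refine S.big_of_le (by unfold pos; positivity) ?_
  unfold pos
  exact_mod_cast S.pos_le u v

variable {S} {σ : Store} {Q : Store → Prop} {r x y bk : ℕ} {vx vy : ℤ}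

lemma within_const {c : ℤ} (hc : S.Big c) (h : Q (σ.setReg r c)) :
    Within S.w (.const r c) σ S.K Q :=
  ⟨_, _, .const .., S.len_le_K hc, h⟩

lemma within_add (hx : σ.reg x = vx) (hy : σ.reg y = vy) (bx : S.Big vx) (b_y : S.Big vy)
    (bz : S.Big (vx + vy)) (h : Q (σ.setReg r (vx + vy))) :
    Within S.w (.arith .add r x y) σ S.K Q := by
  subst hx hy
  refine ⟨_, _, .arith .., ?_, h⟩
  have h₁ := S.three_mul_len_le bx
  have h₂ := S.three_mul_len_le b_y
  have h₃ := S.three_mul_len_le bz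
  simp only [Op.cost, Op.eval]
  omega

lemma within_copy (hx : σ.reg x = vx) (hy : σ.reg 4 = 0) (bx : S.Big vx)
    (h : Q (σ.setReg r vx)) : Within S.w (.arith .add r x 4) σ S.K Q :=
  within_add hx hy bx S.big_zero (by simpa using bx) (by simpa using h)

lemma within_sub (hx : σ.reg x = vx) (hy : σ.reg y = vy) (bx : S.Big vx) (b_y : S.Big vy)
    (bz : S.Big (vx - vy)) (h : Q (σ.setReg r (vx - vy))) :
    Within S.w (.arith .sub r x y) σ S.K Q := by
  subst hx hy
  refine ⟨_, _, .arith .., ?_, h⟩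
  have h₁ := S.three_mul_len_le bx
  have h₂ := S.three_mul_len_le b_y
  have h₃ := S.three_mul_len_le bz
  simp only [Op.cost, Op.eval]
  omega

lemma within_pred {j : ℕ} (hx : σ.reg x = ((j + 1 : ℕ) : ℤ)) (hy : σ.reg 5 = 1)
    (hj : j + 1 ≤ 2 ^ S.w) (h : Q (σ.setReg r j)) :
    Within S.w (.arith .sub r x 5) σ S.K Q :=
  have e : (((j + 1 : ℕ) : ℤ) - 1) = j := by push_cast; ring
  within_sub hx hy (S.big_natCast hj) S.big_one
    (by rw [e]; exact S.big_natCast (by omega)) (by rwa [e])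

/-- Schoolbook multiplication of long numbers would cost the square of their length. It is used only
for addresses, whose factors have at most three and two words, so its cost is constant. -/
lemma within_mul {a b : ℕ} (hx : σ.reg x = a) (hy : σ.reg y = b) (ha : a < 2 ^ (2 * S.w))
    (hb : b < 2 ^ S.w) (h : Q (σ.setReg r (a * b))) :
    Within S.w (.arith .mul r x y) σ S.K Q := by
  refine ⟨_, _, .arith .., ?_, ?_⟩
  · rw [hx, hy]
    have h₁ : len S.w a ≤ 2 + 0 + 1 := len_le S.one_le_w 2 0 (by simpa using ha)
    have h₂ : len S.w b ≤ 1 + 0 + 1 := len_le S.one_le_w 1 0 (by simpa using hb)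
    simp only [Op.cost]
    calc len S.w a * len S.w b ≤ 3 * 2 := Nat.mul_le_mul h₁ h₂
      _ ≤ S.K := by unfold K; omega
  · rw [hx, hy]
    exact h

lemma within_load {a v : ℤ} (hx : σ.reg x = a) (hv : σ.mem bk a = v) (ba : S.Big a)
    (bv : S.Big v) (h : Q (σ.setReg r v)) : Within S.w (.load r bk x) σ S.K Q := by
  subst hx hv
  refine ⟨_, _, .load .., ?_, h⟩
  have h₁ := S.three_mul_len_le ba
  have h₂ := S.three_mul_len_le bv
  omega

lemma within_store {a v : ℤ} (hx : σ.reg x = a) (hv : σ.reg r = v) (ba : S.Big a)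
    (bv : S.Big v) (h : Q (σ.setMem bk a v)) : Within S.w (.store bk x r) σ S.K Q := by
  subst hx hv
  refine ⟨_, _, .store .., ?_, h⟩
  have h₁ := S.three_mul_len_le ba
  have h₂ := S.three_mul_len_le bv
  omega

lemma within_branch {c d : Cmd} {T : ℕ} {v : ℤ} (hr : σ.reg r = v) (bv : S.Big v)
    (h : 0 < v → Within S.w c σ (T - S.K) Q) (h' : v ≤ 0 → Within S.w d σ (T - S.K) Q)
    (hT : S.K ≤ T := by omega) : Within S.w (.branch r c d) σ T Q := by
  subst hr
  exact .branch (S.len_le_K bv) hT h h'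

lemma within_skip {T : ℕ} (h : Q σ) (hT : S.K ≤ T := by omega) : Within S.w .skip σ T Q :=
  .skip (S.one_le_K.trans hT) h

lemma _root_.WordRAM.Store.setReg_setReg (σ : Store) (r : ℕ) (x y : ℤ) :
    (σ.setReg r x).setReg r y = σ.setReg r y := by
  simp [Store.setReg]

/-- `r := (i * m + q) * n + v`, for registers `i`, `q`, `v`; register 0 holds `n` and register 32
holds `m`. -/
def adrCmd (r i q v : ℕ) : Cmd :=
  .seq (.arith .mul r i 32) <| .seq (.arith .add r r q) <|
  .seq (.arith .mul r r 0) (.arith .add r r v)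

/-- `r := u * n + v`, for registers `u`, `v`; register 0 holds `n`. -/
def posCmd (r u v : ℕ) : Cmd :=
  .seq (.arith .mul r u 0) (.arith .add r r v)

lemma within_adrCmd {r ri rq rv : ℕ} {i : ℕ} {q : Fin m} {v : Fin n} (hi : σ.reg ri = i)
    (hq : σ.reg rq = (q : ℕ)) (hv : σ.reg rv = (v : ℕ)) (hn : σ.reg 0 = n) (hm : σ.reg 32 = m)
    (hik : i < S.k) (hr : r ≠ 0 ∧ r ≠ rq ∧ r ≠ rv) (h : Q (σ.setReg r (S.adr i q v))) :
    Within S.w (adrCmd r ri rq rv) σ (4 * S.K) Q := by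
  obtain ⟨h0, h2, h3⟩ := hr
  have hrow := S.row_lt hik q
  have hadr := S.adr_le hik q v
  have hrow' : (i * m + q : ℕ) ≤ 2 ^ (3 * S.w) :=
    hrow.le.trans (Nat.pow_le_pow_right (by norm_num) (by omega))
  have hi2 : i < 2 ^ (2 * S.w) :=
    ((hik.trans_le S.k_le).trans S.n_lt).trans_le (Nat.pow_le_pow_right (by norm_num) (by omega))
  have hb (z : ℕ) (hz : z ≤ 2 ^ (3 * S.w)) : S.Big z :=
    S.big_of_le (by positivity) (by exact_mod_cast hz)
  refine .seq (within_mul hi hm hi2 S.m_lt (.seq (within_add (vx := (i * m : ℕ)) (vy := (q : ℕ))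
    (by simp) ?_ (hb _ (by omega)) (S.big_natCast (S.state_le_pow q)) ?_
    (.seq (within_mul (a := i * m + q) (b := n) ?_ ?_ hrow S.n_lt
    ((within_add (vx := ((i * m + q) * n : ℕ)) (vy := (v : ℕ)) ?_ ?_ (hb _ (by omega))
      (S.big_natCast (S.fin_le_pow v)) ?_ ?_).le))))))
  · simp [Ne.symm h2, hq]
  · exact_mod_cast hb _ hrow'
  · simp
  · simp [Ne.symm h0, hn]
  · simp
  · simp [Ne.symm h3, hv]
  · exact_mod_cast hb _ hadr
  · simp only [Store.setReg_setReg]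
    convert h using 2
    simp [adr]

lemma within_posCmd {r ru rv : ℕ} {u v : Fin n} (hu : σ.reg ru = (u : ℕ))
    (hv : σ.reg rv = (v : ℕ)) (hn : σ.reg 0 = n) (hr : r ≠ rv) (h : Q (σ.setReg r (S.pos u v))) :
    Within S.w (posCmd r ru rv) σ (2 * S.K) Q := by
  have hpos := S.pos_le u v
  have hb (z : ℕ) (hz : z ≤ 2 ^ (3 * S.w)) : S.Big z :=
    S.big_of_le (by positivity) (by exact_mod_cast hz)
  have hu2 : (u : ℕ) < 2 ^ (2 * S.w) :=
    (u.2.trans S.n_lt).trans_le (Nat.pow_le_pow_right (by norm_num) (by omega))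
  refine .seq (within_mul hu hn hu2 S.n_lt ((within_add (vx := (u * n : ℕ)) (vy := (v : ℕ))
    (by simp) ?_ (hb _ (by omega)) (S.big_natCast (S.fin_le_pow v)) ?_ ?_).le))
  · simp [Ne.symm hr, hv]
  · exact_mod_cast hb _ hpos
  · simp only [Store.setReg_setReg]
    convert h using 2
    simp [pos]

/-- The contents of the registers that keep their values: 0 to 3 hold the input, 4 and 5 the
numbers 0 and 1, and 32, 33, 34 describe the automaton. -/
structure Regs (S : Setup n m) (σ : Store) : Prop where
  reg_n : σ.reg 0 = n
  reg_k : σ.reg 1 = S.k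
  reg_a : σ.reg 2 = (S.a : ℕ)
  reg_b : σ.reg 3 = (S.b : ℕ)
  reg_zero : σ.reg 4 = 0
  reg_one : σ.reg 5 = 1
  reg_m : σ.reg 32 = m
  reg_d : σ.reg 33 = S.d
  reg_q₀ : σ.reg 34 = (S.q₀ : ℕ)

/-- The contents of the registers and banks that keep their values. -/
structure Ctx (S : Setup n m) (σ : Store) : Prop extends Regs S σ where
  adj : ∀ u v, σ.mem 0 (S.pos u v) = 1 ∧ S.G.Adj u v ∨ σ.mem 0 (S.pos u v) = 0 ∧ ¬ S.G.Adj u v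
  wt : ∀ u v, S.G.Adj u v → σ.mem 1 (S.pos u v) = S.wt u v
  src : ∀ t : Fin S.d, σ.mem 8 (t : ℕ) = ((S.e t).1 : ℕ)
  lab : ∀ t : Fin S.d, σ.mem 9 (t : ℕ) = ((S.e t).2.1 : ℕ)
  tgt : ∀ t : Fin S.d, σ.mem 10 (t : ℕ) = ((S.e t).2.2 : ℕ)
  acc : ∀ q : Fin m, σ.mem 11 (q : ℕ) = 1 ∧ q ∈ S.M.accept ∨
    σ.mem 11 (q : ℕ) = 0 ∧ q ∉ S.M.accept

/-- Registers 6 to 31 are scratch space. From 32 on lies the area in which `P` has run. -/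
lemma Regs.congr {τ : Store} (h : Regs S σ) (hr : ∀ r, r < 6 ∨ 32 ≤ r → τ.reg r = σ.reg r) :
    Regs S τ := by
  constructor
  · rw [hr _ (by omega), h.reg_n]
  · rw [hr _ (by omega), h.reg_k]
  · rw [hr _ (by omega), h.reg_a]
  · rw [hr _ (by omega), h.reg_b]
  · rw [hr _ (by omega), h.reg_zero]
  · rw [hr _ (by omega), h.reg_one]
  · rw [hr _ (by omega), h.reg_m]
  · rw [hr _ (by omega), h.reg_d]
  · rw [hr _ (by omega), h.reg_q₀]

lemma Regs.setReg (h : Regs S σ) (hr : 6 ≤ r ∧ r < 32) (x : ℤ) : Regs S (σ.setReg r x) :=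
  h.congr fun r' hr' => by rw [Store.reg_setReg, if_neg (by omega)]

lemma Regs.setMem (h : Regs S σ) (b : ℕ) (a x : ℤ) : Regs S (σ.setMem b a x) :=
  h.congr fun _ _ => rfl

lemma Ctx.setReg (h : Ctx S σ) (hr : 6 ≤ r ∧ r < 32) (x : ℤ) : Ctx S (σ.setReg r x) :=
  { h.toRegs.setReg hr x with
    adj := h.adj
    wt := h.wt
    src := h.src
    lab := h.lab
    tgt := h.tgt
    acc := h.acc }

lemma Ctx.setMem (h : Ctx S σ) {b : ℕ} (hb : 2 ≤ b ∧ b < 8) (a x : ℤ) :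
    Ctx S (σ.setMem b a x) := by
  have e (b' : ℕ) (hb' : b' < 2 ∨ 8 ≤ b') : (σ.setMem b a x).mem b' = σ.mem b' := by
    rw [Store.mem_setMem, if_neg (by omega)]
  exact
  { h.toRegs.setMem b a x with
    adj := by rw [e _ (by omega)]; exact h.adj
    wt := by rw [e _ (by omega)]; exact h.wt
    src := by rw [e _ (by omega)]; exact h.src
    lab := by rw [e _ (by omega)]; exact h.lab
    tgt := by rw [e _ (by omega)]; exact h.tgt
    acc := by rw [e _ (by omega)]; exact h.acc }

end Setup
end KPath

/-! ### Relaxing the edges of one transition -/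

namespace KPath
open WordRAM
namespace Setup

variable {n m : ℕ} {S : Setup n m}

/-- Relaxes the edges from the entry `(i, q, v)` that belong to a transition `(q, v, q')` and the
vertex `u`.  Register 20 holds `i + 1`, registers 9, 10, 11 hold `q`, `v`, `q'`, register 14 holds
the distance of `(i, q, v)` and register 15 counts down the vertices `u`.  Banks 2 to 5 hold the
tables. -/
def relaxCmd : Cmd :=
  .seq (.arith .sub 15 15 5) <| .seq (posCmd 16 10 15) <| .seq (.load 13 0 16) <|
  .branch 13
    (.seq (.load 17 1 16) <| .seq (.arith .add 17 14 17) <| .seq (adrCmd 18 20 11 15) <|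
      .seq (.load 13 2 18) <| .branch 13
        (.seq (.load 13 3 18) <| .seq (.arith .sub 13 13 17) <| .branch 13
          (.seq (.store 2 18 5) <| .seq (.store 3 18 17) <|
            .seq (.store 4 18 9) (.store 5 18 10))
          .skip)
        (.seq (.store 2 18 5) <| .seq (.store 3 18 17) <|
            .seq (.store 4 18 9) (.store 5 18 10)))
    .skip

/-- Relaxes the edges that belong to one transition, in the layer whose number is held by
register 6; register 8 counts down the transitions. -/
def transitionCmd : Cmd :=
  .seq (.arith .sub 8 8 5) <| .seq (.load 9 8 8) <| .seq (.load 10 9 8) <|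
  .seq (.load 11 10 8) <| .seq (adrCmd 12 6 9 10) <| .seq (.load 13 2 12) <|
  .branch 13
    (.seq (.load 14 3 12) <| .seq (.arith .add 15 0 4) (.loop 15 relaxCmd))
    .skip

/-- Processes one layer; register 7 counts down the layers. -/
def layerCmd : Cmd :=
  .seq (.arith .sub 7 7 5) <| .seq (.arith .add 20 6 5) <| .seq (.arith .add 8 33 4) <|
  .seq (.loop 8 transitionCmd) (.arith .add 6 20 4)

/-- The edges from the layer `i` that belong to transitions of index at least `c` are relaxed. -/
def Relaxes (S : Setup n m) (mark dist : ℤ → ℤ) (i c : ℕ) : Prop :=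
  ∀ t : Fin S.d, c ≤ t → ∀ u, S.Relaxed mark dist i (S.e t).1 (S.e t).2.1 (S.e t).2.2 u

/-- The invariant of the loop over the transitions in the layer `i`. -/
structure TransitionInv (S : Setup n m) (i j c : ℕ) (σ : Store) : Prop extends Ctx S σ,
    S.Layers (σ.mem 2) (σ.mem 3) (σ.mem 4) (σ.mem 5) i (i + 1) where
  r6 : σ.reg 6 = i
  r7 : σ.reg 7 = j
  r8 : σ.reg 8 = c
  r20 : σ.reg 20 = ((i + 1 : ℕ) : ℤ)
  le : c ≤ S.d
  relaxes : S.Relaxes (σ.mem 2) (σ.mem 3) i c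

/-- The invariant of the loop over the vertices, for the transition `t` in the layer `i`. -/
structure VertexInv (S : Setup n m) (i j : ℕ) (t : Fin S.d) (c : ℕ) (σ : Store) : Prop
    extends Ctx S σ, S.Layers (σ.mem 2) (σ.mem 3) (σ.mem 4) (σ.mem 5) i (i + 1) where
  r6 : σ.reg 6 = i
  r7 : σ.reg 7 = j
  r8 : σ.reg 8 = (t : ℕ)
  r9 : σ.reg 9 = ((S.e t).1 : ℕ)
  r10 : σ.reg 10 = ((S.e t).2.1 : ℕ)
  r11 : σ.reg 11 = ((S.e t).2.2 : ℕ)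
  r14 : σ.reg 14 = σ.mem 3 (S.adr i (S.e t).1 (S.e t).2.1)
  r15 : σ.reg 15 = c
  r20 : σ.reg 20 = ((i + 1 : ℕ) : ℤ)
  le : c ≤ n
  marked : σ.mem 2 (S.adr i (S.e t).1 (S.e t).2.1) = 1
  relaxes : S.Relaxes (σ.mem 2) (σ.mem 3) i (t + 1)
  relaxed' : ∀ u : Fin n, c ≤ u →
    S.Relaxed (σ.mem 2) (σ.mem 3) i (S.e t).1 (S.e t).2.1 (S.e t).2.2 u

/-- Common end of the two branches that write: the target is unmarked, or its old distance is
larger. Here `σ` is the store at the start of the iteration, and `σ'` differs from it only in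
scratch registers. -/
lemma within_update {i j c : ℕ} {t : Fin S.d} {σ : Store} {x : ℤ} {u : Fin n} (hi : i + 1 < S.k)
    (h : S.VertexInv i j t (c + 1) σ) (hu : (u : ℕ) = c) (σ' : Store)
    (hmem : σ'.mem = σ.mem) (hreg : ∀ r, r ∉ [13, 15, 16, 17, 18] → σ'.reg r = σ.reg r)
    (hadj : S.G.Adj (S.e t).2.1 u)
    (h15 : σ'.reg 15 = c) (h17 : σ'.reg 17 = x)
    (h18 : σ'.reg 18 = S.adr (i + 1) (S.e t).2.2 u)
    (hx : x = σ.mem 3 (S.adr i (S.e t).1 (S.e t).2.1) + S.wt (S.e t).2.1 u) (bx : S.Big x)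
    (hlt : σ.mem 2 (S.adr (i + 1) (S.e t).2.2 u) = 1 →
      x ≤ σ.mem 3 (S.adr (i + 1) (S.e t).2.2 u)) :
    Within S.w (.seq (.store 2 18 5) <| .seq (.store 3 18 17) <|
      .seq (.store 4 18 9) (.store 5 18 10)) σ' (4 * S.K)
      (S.VertexInv i j t c) := by
  have bt := S.big_adr hi (S.e t).2.2 u
  refine .seq (within_store h18 ((hreg 5 (by decide)).trans h.reg_one) bt S.big_one ?_)
  refine .seq (within_store h18 (by simpa using h17) bt bx ?_)
  refine .seq (within_store h18 ((hreg 9 (by decide)).trans h.r9) bt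
    (S.big_natCast (S.state_le_pow _)) ?_)
  refine .le (T := S.K) (within_store h18 ((hreg 10 (by decide)).trans h.r10) bt
    (S.big_natCast (S.fin_le_pow _)) ?_)
  have hR : S.Regs σ' := h.toRegs.congr fun r hr => hreg r (by simp; omega)
  have hC : S.Ctx σ' :=
    { hR with
      adj := by rw [hmem]; exact h.adj
      wt := by rw [hmem]; exact h.wt
      src := by rw [hmem]; exact h.src
      lab := by rw [hmem]; exact h.lab
      tgt := by rw [hmem]; exact h.tgt
      acc := by rw [hmem]; exact h.acc }
  have hL := h.toLayers.update h.marked (S.mem_e t) hadj hx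
  have e₁ : S.adr i (S.e t).1 (S.e t).2.1 ≠ S.adr (i + 1) (S.e t).2.2 u := fun h' => by
    have := (S.adr_inj.1 h').1
    omega
  exact
  { (((hC.setMem (b := 2) (by omega) _ _).setMem (b := 3) (by omega) _ _).setMem (b := 4)
      (by omega) _ _).setMem (b := 5) (by omega) _ _ with
    toLayers := by simpa [hmem] using hL
    r6 := (hreg _ (by decide)).trans h.r6
    r7 := (hreg _ (by decide)).trans h.r7
    r8 := (hreg _ (by decide)).trans h.r8
    r9 := (hreg _ (by decide)).trans h.r9
    r10 := (hreg _ (by decide)).trans h.r10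
    r11 := (hreg _ (by decide)).trans h.r11
    -- The source entry lies in layer `i`, so its distance is untouched by writing into layer `i +
    -- 1`.
    r14 := by
      have : σ'.reg 14 = _ := (hreg _ (by decide)).trans h.r14
      simp [hmem, e₁, this]
    r15 := h15
    r20 := (hreg _ (by decide)).trans h.r20
    le := (Nat.le_succ c).trans h.le
    marked := by
      simp [hmem, e₁, h.marked]
    relaxes := by
      intro t' ht' u'
      simpa [hmem] using (h.relaxes t' ht' u').update hlt
    relaxed' := by
      intro u' hu'
      rcases hu'.eq_or_lt with he | hl
      · obtain rfl : u = u' := Fin.ext (hu.trans he)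
        subst hx
        simpa [hmem] using relaxed_update_self
      · simpa [hmem] using (h.relaxed' u' hl).update hlt }

lemma VertexInv.big_dist {i j c : ℕ} {t : Fin S.d} {σ : Store} (hi : i + 1 < S.k)
    (h : S.VertexInv i j t c σ) {u : Fin n} (hu : S.G.Adj (S.e t).2.1 u) :
    |σ.mem 3 (S.adr i (S.e t).1 (S.e t).2.1) + S.wt (S.e t).2.1 u| ≤ S.k * S.W := by
  have h₁ := h.toSound.abs_dist_le i _ _ h.marked
  have h₂ := S.abs_wt _ _ hu
  have h₃ := abs_add_le (σ.mem 3 (S.adr i (S.e t).1 (S.e t).2.1)) (S.wt (S.e t).2.1 u)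
  have h₄ : ((i : ℤ) + 1) * S.W ≤ S.k * S.W := by
    exact_mod_cast Nat.mul_le_mul_right S.W hi.le
  linarith

lemma Sound.abs_dist_le_k {mark dist pq pv : ℤ → ℤ} (h : S.Sound mark dist pq pv) {i : ℕ}
    (hi : i < S.k) {q : Fin m} {v : Fin n} (hm : mark (S.adr i q v) = 1) :
    |dist (S.adr i q v)| ≤ S.k * S.W :=
  (h.abs_dist_le i q v hm).trans (by exact_mod_cast Nat.mul_le_mul_right S.W hi.le)

lemma big_of_abs_le_k {x : ℤ} (h : |x| ≤ S.k * S.W) : S.Big x := by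
  refine S.big_of_abs_le (h.trans ?_)
  have : (0 : ℤ) ≤ S.k * S.W := by positivity
  have : (0 : ℤ) ≤ S.W := by positivity
  nlinarith

lemma big_sub_of_abs_le_k {x y : ℤ} (hx : |x| ≤ S.k * S.W) (hy : |y| ≤ S.k * S.W) :
    S.Big (x - y) := by
  refine S.big_of_abs_le ((abs_sub x y).trans ?_)
  have : (0 : ℤ) ≤ S.W := by positivity
  nlinarith

lemma big_wt {u v : Fin n} (h : S.G.Adj u v) : S.Big (S.wt u v) := by
  refine big_of_abs_le_k ((S.abs_wt u v h).trans ?_)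
  exact_mod_cast Nat.le_mul_of_pos_left S.W S.one_le_k

lemma big_bit {x : ℤ} (h : x = 0 ∨ x = 1) : S.Big x := by
  rcases h with rfl | rfl
  exacts [S.big_zero, S.big_one]

/-- The invariant after an iteration that changes nothing but scratch registers. -/
lemma VertexInv.skip {i j c : ℕ} {t : Fin S.d} {σ σ' : Store} {u : Fin n}
    (h : S.VertexInv i j t (c + 1) σ) (hu : (u : ℕ) = c)
    (hmem : σ'.mem = σ.mem) (hreg : ∀ r, r ∉ [13, 15, 16, 17, 18] → σ'.reg r = σ.reg r)
    (h15 : σ'.reg 15 = c)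
    (hr : S.Relaxed (σ.mem 2) (σ.mem 3) i (S.e t).1 (S.e t).2.1 (S.e t).2.2 u) :
    S.VertexInv i j t c σ' := by
  have hR : S.Regs σ' := h.toRegs.congr fun r hr => hreg r (by simp; omega)
  exact
  { hR with
    adj := by rw [hmem]; exact h.adj
    wt := by rw [hmem]; exact h.wt
    src := by rw [hmem]; exact h.src
    lab := by rw [hmem]; exact h.lab
    tgt := by rw [hmem]; exact h.tgt
    acc := by rw [hmem]; exact h.acc
    toLayers := by rw [hmem]; exact h.toLayers
    r6 := (hreg _ (by decide)).trans h.r6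
    r7 := (hreg _ (by decide)).trans h.r7
    r8 := (hreg _ (by decide)).trans h.r8
    r9 := (hreg _ (by decide)).trans h.r9
    r10 := (hreg _ (by decide)).trans h.r10
    r11 := (hreg _ (by decide)).trans h.r11
    r14 := by rw [hmem]; exact (hreg _ (by decide)).trans h.r14
    r15 := h15
    r20 := (hreg _ (by decide)).trans h.r20
    le := (Nat.le_succ c).trans h.le
    marked := by rw [hmem]; exact h.marked
    relaxes := by rw [hmem]; exact h.relaxes
    relaxed' := by
      intro u' hu'
      rw [hmem]
      rcases hu'.eq_or_lt with he | hl
      · obtain rfl : u = u' := Fin.ext (hu.trans he)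
        exact hr
      · exact h.relaxed' u' hl }

/-- The constant 20 counts the instructions on the longest branch, where a marked target receives a
smaller distance: 16 up to the last test and 4 stores. -/
lemma within_relaxCmd {i j c : ℕ} {t : Fin S.d} {σ : Store} (hi : i + 1 < S.k)
    (h : S.VertexInv i j t (c + 1) σ) :
    Within S.w relaxCmd σ (20 * S.K) (S.VertexInv i j t c) := by
  have hc : c < n := h.le
  obtain ⟨u, hu⟩ : ∃ u : Fin n, (u : ℕ) = c := ⟨⟨c, hc⟩, rfl⟩
  refine .seq (within_pred (j := c) h.r15 h.reg_one (S.nat_le_pow hc) ?_)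
  refine .seq (within_posCmd (u := (S.e t).2.1) (v := u) (by simp [h.r10]) (by simp [hu])
    (by simp [h.reg_n]) (by decide) ?_)
  refine .seq (within_load (a := S.pos (S.e t).2.1 u) (v := σ.mem 0 (S.pos (S.e t).2.1 u))
    (by simp) (by simp) (S.big_pos _ _) (big_bit ?_) ?_)
  · rcases h.adj (S.e t).2.1 u with h' | h'
    exacts [.inr h'.1, .inl h'.1]
  refine within_branch (v := σ.mem 0 (S.pos (S.e t).2.1 u)) (by simp) (big_bit ?_) ?_ ?_
  · rcases h.adj (S.e t).2.1 u with h' | h'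
    exacts [.inr h'.1, .inl h'.1]
  · intro hpos
    have hadj : S.G.Adj (S.e t).2.1 u := by
      rcases h.adj (S.e t).2.1 u with h' | h'
      · exact h'.2
      · omega
    have hk := h.big_dist hi hadj
    have hold : σ.mem 2 (S.adr (i + 1) (S.e t).2.2 u) = 1 →
        |σ.mem 3 (S.adr (i + 1) (S.e t).2.2 u)| ≤ S.k * S.W := h.abs_dist_le_k hi
    refine .seq (within_load (a := S.pos (S.e t).2.1 u) (v := S.wt (S.e t).2.1 u)
      (by simp) (by simp [h.wt _ _ hadj]) (S.big_pos _ _) (big_wt hadj) ?_)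
    refine .seq (within_add (vx := σ.mem 3 (S.adr i (S.e t).1 (S.e t).2.1))
      (vy := S.wt (S.e t).2.1 u) (by simp [h.r14]) (by simp)
      (big_of_abs_le_k (h.abs_dist_le_k (by omega) h.marked)) (big_wt hadj)
      (big_of_abs_le_k hk) ?_)
    refine .seq (within_adrCmd (i := i + 1) (q := (S.e t).2.2) (v := u) (by simp [h.r20])
      (by simp [h.r11]) (by simp [hu]) (by simp [h.reg_n]) (by simp [h.reg_m]) hi
      (by decide) ?_)
    refine .seq (within_load (a := S.adr (i + 1) (S.e t).2.2 u)
      (v := σ.mem 2 (S.adr (i + 1) (S.e t).2.2 u)) (by simp) (by simp)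
      (S.big_adr hi _ _) (big_bit (h.bin ..)) ?_)
    refine within_branch (v := σ.mem 2 (S.adr (i + 1) (S.e t).2.2 u)) (by simp)
      (big_bit (h.bin ..)) ?_ ?_
    · intro hmark
      have hmark : σ.mem 2 (S.adr (i + 1) (S.e t).2.2 u) = 1 := by
        have := h.bin (i + 1) (S.e t).2.2 u
        omega
      refine .seq (within_load (a := S.adr (i + 1) (S.e t).2.2 u)
        (v := σ.mem 3 (S.adr (i + 1) (S.e t).2.2 u)) (by simp) (by simp)
        (S.big_adr hi _ _) (big_of_abs_le_k (hold hmark)) ?_)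
      refine .seq (within_sub (vx := σ.mem 3 (S.adr (i + 1) (S.e t).2.2 u))
        (vy := σ.mem 3 (S.adr i (S.e t).1 (S.e t).2.1) + S.wt (S.e t).2.1 u)
        (by simp) (by simp) (big_of_abs_le_k (hold hmark)) (big_of_abs_le_k hk)
        (big_sub_of_abs_le_k (hold hmark) hk) ?_)
      refine within_branch (v := σ.mem 3 (S.adr (i + 1) (S.e t).2.2 u) -
        (σ.mem 3 (S.adr i (S.e t).1 (S.e t).2.1) + S.wt (S.e t).2.1 u)) (by simp)
        (big_sub_of_abs_le_k (hold hmark) hk) ?_ ?_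
      · intro hlt
        refine .le (T := 4 * S.K) (within_update hi h hu _ rfl ?_ hadj (by simp) (by simp) (by simp) rfl
          (big_of_abs_le_k hk) ?_)
        · intro r hr
          simp only [List.mem_cons, List.not_mem_nil, not_or] at hr
          simp [hr]
        · intro _
          omega
      · intro hle
        refine within_skip (h.skip hu rfl ?_ (by simp) ?_)
        · intro r hr
          simp only [List.mem_cons, List.not_mem_nil, not_or] at hr
          simp [hr]
        · intro _ _
          exact ⟨hmark, by omega⟩
    · intro hmark
      refine .le (T := 4 * S.K) (within_update hi h hu _ rfl ?_ hadj (by simp) (by simp) (by simp) rfl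
        (big_of_abs_le_k hk) ?_)
      · intro r hr
        simp only [List.mem_cons, List.not_mem_nil, not_or] at hr
        simp [hr]
      · intro _
        omega
  · intro hneg
    refine within_skip (h.skip hu rfl ?_ (by simp) ?_)
    · intro r hr
      simp only [List.mem_cons, List.not_mem_nil, not_or] at hr
      simp [hr]
    · intro _ hadj
      rcases h.adj (S.e t).2.1 u with h' | h'
      · omega
      · exact absurd hadj h'.2

end Setup
end KPath

/-! ### The loops over transitions and layers -/

namespace KPath
open WordRAM
namespace Setup

variable {n m : ℕ} {S : Setup n m}

/-- The time for the loop over the vertices. -/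
def vertexTime (S : Setup n m) : ℕ := (n + 1) * (S.K + 20 * S.K)

/-- The time for one transition. -/
def transitionTime (S : Setup n m) : ℕ := 12 * S.K + S.vertexTime

/-- The time for one layer. -/
def layerTime (S : Setup n m) : ℕ := 4 * S.K + (S.d + 1) * (S.K + S.transitionTime)

/-- The invariant of the loop over the layers. -/
structure LayerInv (S : Setup n m) (j : ℕ) (σ : Store) : Prop extends Ctx S σ where
  r7 : σ.reg 7 = j
  lt : j + 1 ≤ S.k
  r6 : σ.reg 6 = ((S.k - 1 - j : ℕ) : ℤ)
  layers : S.Layers (σ.mem 2) (σ.mem 3) (σ.mem 4) (σ.mem 5) (S.k - 1 - j) (S.k - 1 - j)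

lemma within_countdown {c : Cmd} {σ : Store} {T : ℕ} {r : ℕ} (I : ℕ → Store → Prop) (N : ℕ)
    (hN : N ≤ 2 ^ S.w) (hreg : ∀ j σ, I j σ → σ.reg r = j)
    (hbody : ∀ j σ, I (j + 1) σ → Within S.w c σ T (I j)) (h : I N σ) :
    Within S.w (.loop r c) σ ((N + 1) * (S.K + T)) (I 0) :=
  .countdown I hreg hbody N σ (fun _ hj => S.len_le_K (S.big_natCast (hj.trans hN))) h

lemma Layers.mono {mark dist pq pv : ℤ → ℤ} {i l l' : ℕ} (h : S.Layers mark dist pq pv i l)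
    (hl : l ≤ l') : S.Layers mark dist pq pv i l' :=
  { h with fresh := fun j q v hj => h.fresh j q v (hl.trans_lt hj) }

lemma Ctx.congr {σ τ : Store} (h : Ctx S σ) (hr : ∀ r, r < 6 ∨ 32 ≤ r → τ.reg r = σ.reg r)
    (hm : τ.mem = σ.mem) : Ctx S τ :=
  { h.toRegs.congr hr with
    adj := by rw [hm]; exact h.adj
    wt := by rw [hm]; exact h.wt
    src := by rw [hm]; exact h.src
    lab := by rw [hm]; exact h.lab
    tgt := by rw [hm]; exact h.tgt
    acc := by rw [hm]; exact h.acc }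

lemma within_transitionCmd {i j c : ℕ} {σ : Store} (hi : i + 1 < S.k)
    (h : S.TransitionInv i j (c + 1) σ) :
    Within S.w transitionCmd σ S.transitionTime (S.TransitionInv i j c) := by
  have hc : c < S.d := h.le
  obtain ⟨t, ht⟩ : ∃ t : Fin S.d, (t : ℕ) = c := ⟨⟨c, hc⟩, rfl⟩
  subst ht
  have bt : S.Big (t : ℕ) := S.big_natCast (S.transition_le_pow hc.le)
  have bq (q : Fin m) : S.Big (q : ℕ) := S.big_natCast (S.state_le_pow q)
  have bv (v : Fin n) : S.Big (v : ℕ) := S.big_natCast (S.fin_le_pow v)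
  have bs := S.big_adr (i := i) (by omega) (S.e t).1 (S.e t).2.1
  have bm := big_bit (S := S) (h.bin i (S.e t).1 (S.e t).2.1)
  unfold transitionTime
  refine .seq (within_pred (j := t) h.r8 h.reg_one (S.transition_le_pow hc) ?_)
  refine .seq (within_load (a := (t : ℕ)) (v := ((S.e t).1 : ℕ)) (by simp) (by simp [h.src]) bt
    (bq _) ?_)
  refine .seq (within_load (a := (t : ℕ)) (v := ((S.e t).2.1 : ℕ)) (by simp) (by simp [h.lab]) bt
    (bv _) ?_)
  refine .seq (within_load (a := (t : ℕ)) (v := ((S.e t).2.2 : ℕ)) (by simp) (by simp [h.tgt]) bt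
    (bq _) ?_)
  refine .seq (within_adrCmd (i := i) (q := (S.e t).1) (v := (S.e t).2.1) (by simp [h.r6])
    (by simp) (by simp) (by simp [h.reg_n]) (by simp [h.reg_m]) (by omega) (by decide) ?_)
  refine .seq (within_load (a := S.adr i (S.e t).1 (S.e t).2.1)
    (v := σ.mem 2 (S.adr i (S.e t).1 (S.e t).2.1)) (by simp) (by simp) bs bm ?_)
  refine within_branch (v := σ.mem 2 (S.adr i (S.e t).1 (S.e t).2.1)) (by simp) bm ?_ ?_
  · intro hpos
    have hm : σ.mem 2 (S.adr i (S.e t).1 (S.e t).2.1) = 1 := by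
      have := h.bin i (S.e t).1 (S.e t).2.1
      omega
    refine .seq (within_load (a := S.adr i (S.e t).1 (S.e t).2.1)
      (v := σ.mem 3 (S.adr i (S.e t).1 (S.e t).2.1)) (by simp) (by simp) bs
      (big_of_abs_le_k (h.abs_dist_le_k (by omega) hm)) ?_)
    refine .seq (within_copy (vx := n) (by simp [h.reg_n]) (by simp [h.reg_zero])
      (S.big_natCast (S.nat_le_pow le_rfl)) ?_)
    refine (within_countdown (T := 20 * S.K) (S.VertexInv i j t) n (S.nat_le_pow le_rfl)
      (fun _ _ h => h.r15) (fun _ _ h => within_relaxCmd hi h) ?_).mono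
        (by unfold vertexTime; omega) ?_
    · exact
      { toCtx := h.toCtx.congr (fun r hr => by
          simp [show r ≠ 15 by omega, show r ≠ 14 by omega, show r ≠ 13 by omega,
            show r ≠ 12 by omega, show r ≠ 11 by omega, show r ≠ 10 by omega,
            show r ≠ 9 by omega, show r ≠ 8 by omega]) rfl
        toLayers := h.toLayers
        r6 := by simp [h.r6]
        r7 := by simp [h.r7]
        r8 := by simp
        r9 := by simp
        r10 := by simp
        r11 := by simp
        r14 := by simp
        r15 := by simp
        r20 := by simp [h.r20]
        le := le_rfl
        marked := hm
        relaxes := h.relaxes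
        -- The countdown starts at `n`, so no vertex has been treated yet.
        relaxed' := fun u hu => absurd u.2 (by omega) }
    · intro τ hτ
      exact
      { hτ with
        le := hc.le
        relaxes := by
          intro t' ht' u
          rcases ht'.eq_or_lt with he | hl
          · obtain rfl : t = t' := Fin.ext he
            exact hτ.relaxed' u (Nat.zero_le _)
          · exact hτ.relaxes t' hl u }
  · intro hneg
    refine within_skip ?_
    exact
    { toCtx := h.toCtx.congr (fun r hr => by
        simp [show r ≠ 13 by omega,
          show r ≠ 12 by omega, show r ≠ 11 by omega, show r ≠ 10 by omega,
          show r ≠ 9 by omega, show r ≠ 8 by omega]) rfl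
      toLayers := h.toLayers
      r6 := by simp [h.r6]
      r7 := by simp [h.r7]
      r8 := by simp
      r20 := by simp [h.r20]
      le := hc.le
      relaxes := by
        intro t' ht' u
        rcases ht'.eq_or_lt with he | hl
        · obtain rfl : t = t' := Fin.ext he
          -- An unmarked source has nothing to relax: the premise of `Relaxed` fails.
          intro hm
          simp only [Store.mem_setReg] at hm
          omega
        · exact h.relaxes t' hl u }

lemma within_layerCmd {j : ℕ} {σ : Store} (h : S.LayerInv (j + 1) σ) :
    Within S.w layerCmd σ S.layerTime (S.LayerInv j) := by
  have hj := h.lt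
  obtain ⟨i, hi⟩ : ∃ i, i = S.k - 1 - (j + 1) := ⟨_, rfl⟩
  have hi' : i + 1 = S.k - 1 - j := by omega
  have h6 := h.r6
  have hL := h.layers
  rw [← hi] at h6 hL
  have b₁ : S.Big ((i + 1 : ℕ) : ℤ) := S.big_natCast (S.layer_le_pow (by omega))
  unfold layerTime
  refine .seq (within_pred (j := j) h.r7 h.reg_one (S.layer_le_pow (by omega)) ?_)
  refine .seq (within_add (vx := i) (vy := 1) (by simp [h6]) (by simp [h.reg_one])
    (S.big_natCast (S.layer_le_pow (by omega))) S.big_one (by exact_mod_cast b₁) ?_)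
  refine .seq (within_copy (vx := S.d) (by simp [h.reg_d]) (by simp [h.reg_zero])
    (S.big_natCast (S.transition_le_pow le_rfl)) ?_)
  refine .seq ((within_countdown (T := S.transitionTime) (S.TransitionInv i j) S.d
    (S.transition_le_pow le_rfl) (fun _ _ h => h.r8) (fun _ _ h => within_transitionCmd (by omega) h)
    ?_).mono (le_refl _) ?_)
  · exact
    { toCtx := h.toCtx.congr (fun r hr => by
        simp [show r ≠ 20 by omega, show r ≠ 7 by omega, show r ≠ 8 by omega]) rfl
      -- Layer `i + 1` is opened for writing; so far it is still empty.
      toLayers := hL.mono (by omega)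
      r6 := by simp [h6]
      r7 := by simp
      r8 := by simp
      r20 := by simp
      le := le_rfl
      relaxes := fun t ht => absurd t.2 (by omega) }
  · intro τ hτ
    refine .le (T := S.K) (within_copy hτ.r20 hτ.reg_zero b₁ ?_)
    exact
    { toCtx := hτ.toCtx.setReg (by omega) _
      r7 := by simp [hτ.r7]
      lt := by omega
      r6 := by simp [hi']
      layers := by
        rw [← hi']
        exact
        { hτ.toLayers with
          relaxed := by
            intro j' hj' q v q' u hq
            rcases Nat.lt_succ_iff_lt_or_eq.1 hj' with hl | rfl
            · exact hτ.relaxed j' hl q v q' u hq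
            -- The list contains every transition, so after the countdown all edges leaving layer
            -- `i` are relaxed.
            · obtain ⟨t, ht⟩ := S.exists_e q v q' hq
              simpa [ht] using hτ.relaxes t (Nat.zero_le _) u } }

/-! ### Selecting the best final entry -/

/-- Compares the entry at the end of the last layer that a transition completes to an accepted
walk, if there is one, with the best such entry so far.  Register 21 says whether there is one,
register 22 holds its distance and register 23 its state. -/
def selectCmd : Cmd :=
  .seq (.arith .sub 8 8 5) <| .seq (.load 9 8 8) <| .seq (.load 10 9 8) <|
  .seq (.load 11 10 8) <| .seq (.load 13 11 11) <| .branch 13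
    (.seq (.arith .sub 16 10 3) <| .branch 16 .skip <|
      .seq (.arith .sub 16 3 10) <| .branch 16 .skip <|
      .seq (adrCmd 12 6 9 10) <| .seq (.load 13 2 12) <| .branch 13
        (.seq (.load 14 3 12) <| .branch 21
          (.seq (.arith .sub 13 22 14) <| .branch 13
            (.seq (.const 21 1) <| .seq (.arith .add 22 14 4) (.arith .add 23 9 4))
            .skip)
          (.seq (.const 21 1) <| .seq (.arith .add 22 14 4) (.arith .add 23 9 4)))
        .skip)
    .skip

/-- The transition `t` completes a walk to `b`. -/
def Completes (S : Setup n m) (mark : ℤ → ℤ) (t : Fin S.d) : Prop :=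
  (S.e t).2.2 ∈ S.M.accept ∧ (S.e t).2.1 = S.b ∧ mark (S.adr (S.k - 1) (S.e t).1 S.b) = 1

/-- The register contents `found`, `best`, `state` describe a best one of the entries that the
transitions of index at least `c` complete to accepted walks. -/
def Selected (S : Setup n m) (mark dist : ℤ → ℤ) (c : ℕ) (found best state : ℤ) : Prop :=
  found = 0 ∧ (∀ t : Fin S.d, c ≤ t → ¬ S.Completes mark t) ∨
    found = 1 ∧ ∃ q : Fin m, S.Final mark q ∧ state = (q : ℕ) ∧
      best = dist (S.adr (S.k - 1) q S.b) ∧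
      ∀ t : Fin S.d, c ≤ t → S.Completes mark t →
        best ≤ dist (S.adr (S.k - 1) (S.e t).1 S.b)

/-- The invariant of the search for the best entry at the end of the last layer. -/
structure SelectInv (S : Setup n m) (c : ℕ) (σ : Store) : Prop extends Ctx S σ,
    S.Layers (σ.mem 2) (σ.mem 3) (σ.mem 4) (σ.mem 5) (S.k - 1) (S.k - 1) where
  r6 : σ.reg 6 = ((S.k - 1 : ℕ) : ℤ)
  r8 : σ.reg 8 = c
  le : c ≤ S.d
  selected : S.Selected (σ.mem 2) (σ.mem 3) c (σ.reg 21) (σ.reg 22) (σ.reg 23)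

lemma Selected.skip {mark dist : ℤ → ℤ} {t : Fin S.d} {f x y : ℤ}
    (h : S.Selected mark dist (t + 1) f x y)
    (ht : S.Completes mark t → f = 1 ∧ x ≤ dist (S.adr (S.k - 1) (S.e t).1 S.b)) :
    S.Selected mark dist t f x y := by
  rcases h with ⟨h₁, h₂⟩ | ⟨h₁, q, h₂, h₃, h₄, h₅⟩
  · refine .inl ⟨h₁, fun t' ht' hc => ?_⟩
    rcases ht'.eq_or_lt with he | hl
    · obtain rfl : t = t' := Fin.ext he
      have := (ht hc).1
      omega
    · exact h₂ t' hl hc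
  · refine .inr ⟨h₁, q, h₂, h₃, h₄, fun t' ht' hc => ?_⟩
    rcases ht'.eq_or_lt with he | hl
    · obtain rfl : t = t' := Fin.ext he
      exact (ht hc).2
    · exact h₅ t' hl hc

lemma Selected.update {mark dist : ℤ → ℤ} {t : Fin S.d} {f x y : ℤ}
    (h : S.Selected mark dist (t + 1) f x y) (hc : S.Completes mark t)
    (ht : f = 1 → dist (S.adr (S.k - 1) (S.e t).1 S.b) ≤ x) :
    S.Selected mark dist t 1 (dist (S.adr (S.k - 1) (S.e t).1 S.b)) ((S.e t).1 : ℕ) := by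
  refine .inr ⟨rfl, (S.e t).1, ⟨hc.2.2, (S.e t).2.2, ?_, hc.1⟩, rfl, rfl, fun t' ht' hc' => ?_⟩
  · rw [← hc.2.1]
    exact S.mem_e t
  · rcases ht'.eq_or_lt with he | hl
    · obtain rfl : t = t' := Fin.ext he
      exact le_rfl
    · rcases h with ⟨-, h₂⟩ | ⟨h₁, q, -, -, -, h₅⟩
      · exact absurd hc' (h₂ t' hl)
      · exact (ht h₁).trans (h₅ t' hl hc')

lemma within_selectCmd {c : ℕ} {σ : Store} (h : S.SelectInv (c + 1) σ) :
    Within S.w selectCmd σ (24 * S.K) (S.SelectInv c) := by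
  have hc : c < S.d := h.le
  obtain ⟨t, ht⟩ : ∃ t : Fin S.d, (t : ℕ) = c := ⟨⟨c, hc⟩, rfl⟩
  subst ht
  have hk := S.one_le_k
  have bt : S.Big (t : ℕ) := S.big_natCast (S.transition_le_pow hc.le)
  have bq (q : Fin m) : S.Big (q : ℕ) := S.big_natCast (S.state_le_pow q)
  have bv (v : Fin n) : S.Big (v : ℕ) := S.big_natCast (S.fin_le_pow v)
  have bsub (u v : Fin n) : S.Big ((u : ℕ) - (v : ℕ) : ℤ) := by
    have h₁ : |((u : ℕ) - (v : ℕ) : ℤ)| ≤ n := abs_le.2 ⟨by omega, by omega⟩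
    have h₂ : |((u : ℕ) - (v : ℕ) : ℤ)| ≤ ((2 ^ S.w : ℕ) : ℤ) :=
      h₁.trans (by exact_mod_cast S.n_lt.le)
    have h₃ := S.big_natCast (le_refl (2 ^ S.w))
    rw [Big, abs_of_nonneg (by positivity)] at h₃
    exact h₂.trans h₃
  have bacc : S.Big (σ.mem 11 ((S.e t).2.2 : ℕ)) := by
    refine big_bit ?_
    rcases h.acc (S.e t).2.2 with h' | h'
    exacts [.inr h'.1, .inl h'.1]
  -- Every branch ends in one of two ways, with the selection kept (`hskip`) or replaced by the
  -- current entry (`hupd`).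
  have hskip (τ : Store) (hmem : τ.mem = σ.mem)
      (hreg : ∀ r, r ∉ [8, 9, 10, 11, 12, 13, 14, 16] → τ.reg r = σ.reg r) (h8 : τ.reg 8 = (t : ℕ))
      (hs : S.Completes (σ.mem 2) t →
        σ.reg 21 = 1 ∧ σ.reg 22 ≤ σ.mem 3 (S.adr (S.k - 1) (S.e t).1 S.b)) : S.SelectInv t τ :=
    { toCtx := h.toCtx.congr (fun r hr => hreg r (by simp; omega)) hmem
      toLayers := by rw [hmem]; exact h.toLayers
      r6 := (hreg _ (by decide)).trans h.r6
      r8 := h8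
      le := hc.le
      selected := by
        rw [hmem, hreg _ (by decide), hreg _ (by decide), hreg _ (by decide)]
        exact h.selected.skip hs }
  have hupd (τ : Store) (hmem : τ.mem = σ.mem)
      (hreg : ∀ r, r ∉ [8, 9, 10, 11, 12, 13, 14, 16] → τ.reg r = σ.reg r) (h8 : τ.reg 8 = (t : ℕ))
      (h9 : τ.reg 9 = ((S.e t).1 : ℕ))
      (h14 : τ.reg 14 = σ.mem 3 (S.adr (S.k - 1) (S.e t).1 S.b))
      (hcomp : S.Completes (σ.mem 2) t)
      (hs : σ.reg 21 = 1 → σ.mem 3 (S.adr (S.k - 1) (S.e t).1 S.b) ≤ σ.reg 22) :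
      Within S.w (.seq (.const 21 1) <| .seq (.arith .add 22 14 4) (.arith .add 23 9 4)) τ
        (3 * S.K) (S.SelectInv t) := by
    refine .seq (within_const S.big_one ?_)
    refine .seq (within_copy (by simpa using h14)
      (by simpa using (hreg 4 (by decide)).trans h.reg_zero)
      (big_of_abs_le_k (h.abs_dist_le_k (by omega) hcomp.2.2)) ?_)
    refine .le (T := S.K) (within_copy (by simpa using h9)
      (by simpa using (hreg 4 (by decide)).trans h.reg_zero) (bq _) ?_)
    exact
    { toCtx := (((h.toCtx.congr (fun r hr => hreg r (by simp; omega)) hmem).setReg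
        (by omega) _).setReg (by omega) _).setReg (by omega) _
      toLayers := by simpa [hmem] using h.toLayers
      r6 := by simpa using (hreg 6 (by decide)).trans h.r6
      r8 := by simpa using h8
      le := hc.le
      selected := by simpa [hmem] using h.selected.update hcomp hs }
  refine .seq (within_pred (j := t) h.r8 h.reg_one (S.transition_le_pow hc) ?_)
  refine .seq (within_load (a := (t : ℕ)) (v := ((S.e t).1 : ℕ)) (by simp) (by simp [h.src]) bt
    (bq _) ?_)
  refine .seq (within_load (a := (t : ℕ)) (v := ((S.e t).2.1 : ℕ)) (by simp) (by simp [h.lab]) bt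
    (bv _) ?_)
  refine .seq (within_load (a := (t : ℕ)) (v := ((S.e t).2.2 : ℕ)) (by simp) (by simp [h.tgt]) bt
    (bq _) ?_)
  refine .seq (within_load (a := ((S.e t).2.2 : ℕ)) (v := σ.mem 11 ((S.e t).2.2 : ℕ)) (by simp)
    (by simp) (bq _) bacc ?_)
  refine within_branch (v := σ.mem 11 ((S.e t).2.2 : ℕ)) (by simp) bacc ?_ ?_
  rotate_left
  · intro hneg
    refine within_skip (hskip _ rfl ?_ (by simp) ?_)
    · intro r hr
      simp only [List.mem_cons, List.not_mem_nil, not_or] at hr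
      simp [hr]
    · intro hcomp
      rcases h.acc (S.e t).2.2 with h' | h'
      · omega
      · exact absurd hcomp.1 h'.2
  intro hpos
  have hacc : (S.e t).2.2 ∈ S.M.accept := by
    rcases h.acc (S.e t).2.2 with h' | h'
    · exact h'.2
    · omega
  refine .seq (within_sub (vx := ((S.e t).2.1 : ℕ)) (vy := (S.b : ℕ)) (by simp)
    (by simp [h.reg_b]) (bv _) (bv _) (bsub _ _) ?_)
  refine within_branch (by simp) (bsub (S.e t).2.1 S.b) ?_ ?_
  · intro hne
    refine within_skip (hskip _ rfl ?_ (by simp) ?_)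
    · intro r hr
      simp only [List.mem_cons, List.not_mem_nil, not_or] at hr
      simp [hr]
    · intro hcomp
      rw [hcomp.2.1] at hne
      omega
  intro hle
  refine .seq (within_sub (vx := (S.b : ℕ)) (vy := ((S.e t).2.1 : ℕ)) (by simp [h.reg_b])
    (by simp) (bv _) (bv _) (bsub _ _) ?_)
  refine within_branch (by simp) (bsub S.b (S.e t).2.1) ?_ ?_
  · intro hne
    refine within_skip (hskip _ rfl ?_ (by simp) ?_)
    · intro r hr
      simp only [List.mem_cons, List.not_mem_nil, not_or] at hr
      simp [hr]
    · intro hcomp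
      rw [hcomp.2.1] at hne
      omega
  intro hge
  -- The machine only tests for positivity, so equality of the label with `b` is detected by two
  -- differences, neither of which is positive.
  have hb : (S.e t).2.1 = S.b := Fin.ext (by omega)
  have bs := S.big_adr (i := S.k - 1) (by omega) (S.e t).1 S.b
  have bm := big_bit (S := S) (h.bin (S.k - 1) (S.e t).1 S.b)
  refine .seq (within_adrCmd (i := S.k - 1) (q := (S.e t).1) (v := S.b) (by simp [h.r6])
    (by simp) (by simp [hb]) (by simp [h.reg_n]) (by simp [h.reg_m]) (by omega) (by decide) ?_)
  refine .seq (within_load (a := S.adr (S.k - 1) (S.e t).1 S.b)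
    (v := σ.mem 2 (S.adr (S.k - 1) (S.e t).1 S.b)) (by simp) (by simp) bs bm ?_)
  refine within_branch (v := σ.mem 2 (S.adr (S.k - 1) (S.e t).1 S.b)) (by simp) bm ?_ ?_
  rotate_left
  · intro hneg
    refine within_skip (hskip _ rfl ?_ (by simp) ?_)
    · intro r hr
      simp only [List.mem_cons, List.not_mem_nil, not_or] at hr
      simp [hr]
    · intro hcomp
      have := hcomp.2.2
      omega
  intro hpos'
  have hm : σ.mem 2 (S.adr (S.k - 1) (S.e t).1 S.b) = 1 := by
    have := h.bin (S.k - 1) (S.e t).1 S.b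
    omega
  have hd := h.abs_dist_le_k (i := S.k - 1) (by omega) hm
  refine .seq (within_load (a := S.adr (S.k - 1) (S.e t).1 S.b)
    (v := σ.mem 3 (S.adr (S.k - 1) (S.e t).1 S.b)) (by simp) (by simp) bs
    (big_of_abs_le_k hd) ?_)
  have b21 : S.Big (σ.reg 21) := by
    refine big_bit ?_
    rcases h.selected with h' | h'
    exacts [.inl h'.1, .inr h'.1]
  refine within_branch (v := σ.reg 21) (by simp) b21 ?_ ?_
  · intro hf
    have hx : σ.reg 21 = 1 ∧ |σ.reg 22| ≤ S.k * S.W := by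
      rcases h.selected with h' | ⟨h₁, q, h₂, -, h₄, -⟩
      · omega
      · exact ⟨h₁, h₄ ▸ h.abs_dist_le_k (by omega) h₂.1⟩
    refine .seq (within_sub (vx := σ.reg 22) (vy := σ.mem 3 (S.adr (S.k - 1) (S.e t).1 S.b))
      (by simp) (by simp) (big_of_abs_le_k hx.2) (big_of_abs_le_k hd)
      (big_sub_of_abs_le_k hx.2 hd) ?_)
    refine within_branch (v := σ.reg 22 - σ.mem 3 (S.adr (S.k - 1) (S.e t).1 S.b)) (by simp)
      (big_sub_of_abs_le_k hx.2 hd) ?_ ?_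
    · intro hlt
      refine .le (T := 3 * S.K) (hupd _ rfl ?_ (by simp) (by simp) (by simp) ⟨hacc, hb, hm⟩ ?_)
      · intro r hr
        simp only [List.mem_cons, List.not_mem_nil, not_or] at hr
        simp [hr]
      · intro _
        omega
    · intro hle
      refine within_skip (hskip _ rfl ?_ (by simp) ?_)
      · intro r hr
        simp only [List.mem_cons, List.not_mem_nil, not_or] at hr
        simp [hr]
      · intro _
        exact ⟨hx.1, by omega⟩
  · intro hf
    refine .le (T := 3 * S.K) (hupd _ rfl ?_ (by simp) (by simp) (by simp) ⟨hacc, hb, hm⟩ ?_)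
    · intro r hr
      simp only [List.mem_cons, List.not_mem_nil, not_or] at hr
      simp [hr]
    · intro _
      omega

end Setup
end KPath

/-! ### Reconstructing the path and writing the answer -/

namespace KPath
open WordRAM
namespace Setup

variable {n m : ℕ} {S : Setup n m}

/-- Follows the table of predecessors; register 7 counts down the layers, registers 9 and 10 hold
the state and the vertex, and the vertices are written to bank 0. -/
def traceCmd : Cmd :=
  .seq (adrCmd 12 7 9 10) <| .seq (.load 9 4 12) <| .seq (.load 10 5 12) <|
  .seq (.arith .sub 7 7 5) (.store 0 7 10)

/-- Writes the answer. -/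
def answerCmd : Cmd :=
  .branch 21
    (.seq (.arith .sub 7 1 5) <| .seq (.arith .add 9 23 4) <| .seq (.arith .add 10 3 4) <|
      .seq (.store 0 7 10) <| .seq (.loop 7 traceCmd) (.const 0 1))
    (.const 0 0)

/-- Solves the path problem when the automaton is in place and registers 7 and above, up to 31, as
well as banks 2 to 5 are empty. -/
def searchCmd : Cmd :=
  .seq (adrCmd 12 6 34 2) <| .seq (.store 2 12 5) <| .seq (.arith .sub 7 1 5) <|
  .seq (.loop 7 layerCmd) <| .seq (.const 21 0) <| .seq (.arith .add 8 33 4) <|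
  .seq (.loop 8 selectCmd) answerCmd

/-- The program that solves the path problem with the automaton constructed by `P`. -/
def solveCmd (P : Cmd) : Cmd :=
  .seq (.const 5 1) <| .seq (.arith .add 32 0 4) <| .seq (.arith .add 33 1 4) <|
  .seq (P.shift 32 8) searchCmd

/-- The invariant of the loop that follows the table of predecessors. -/
structure TraceInv (S : Setup n m) (x : ℤ) (c : ℕ) (σ : Store) : Prop extends Regs S σ,
    S.Layers (σ.mem 2) (σ.mem 3) (σ.mem 4) (σ.mem 5) (S.k - 1) (S.k - 1) where
  best : ∀ q, S.Final (σ.mem 2) q → x ≤ σ.mem 3 (S.adr (S.k - 1) q S.b)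
  lt : c < S.k
  r7 : σ.reg 7 = c
  entry : ∃ (q : Fin m) (v : Fin n) (p : List (Fin n)), σ.reg 9 = (q : ℕ) ∧
    σ.reg 10 = (v : ℕ) ∧ σ.mem 2 (S.adr c q v) = 1 ∧ S.Suffix (σ.mem 3) x c q v p ∧
    ∀ i : Fin (v :: p).length, σ.mem 0 ((c + i : ℕ) : ℤ) = ((v :: p).get i : ℕ)

lemma Suffix.cons {dist : ℤ → ℤ} {x : ℤ} {i : ℕ} {q q' : Fin m} {v u : Fin n} {p : List (Fin n)}
    (h : S.Suffix dist x (i + 1) q' u p) (hq : q' ∈ S.M.step q v) (hu : S.G.Adj v u)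
    (hd : dist (S.adr (i + 1) q' u) = dist (S.adr i q v) + S.wt v u) :
    S.Suffix dist x i q v (u :: p) where
  length := by
    have := h.length
    simp only [List.length_cons]
    omega
  chain := by
    rw [List.isChain_cons_cons]
    exact ⟨hu, h.chain⟩
  last := by simpa using h.last
  accepts := ⟨q', hq, h.accepts⟩
  weight := by
    have := h.weight
    simp only [pathWeight]
    linarith

/-- The path is written backwards: the list already occupies the cells from `c + 1` on, and the new
head goes into cell `c`. -/
lemma forall_update_get {f : ℤ → ℤ} {c : ℕ} {v : Fin n} {p : List (Fin n)}
    (h : ∀ i : Fin p.length, f ((c + 1 + i : ℕ) : ℤ) = (p.get i : ℕ)) :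
    ∀ i : Fin (v :: p).length,
      Function.update f (c : ℤ) (v : ℕ) ((c + i : ℕ) : ℤ) = ((v :: p).get i : ℕ) := by
  rintro ⟨i, hi⟩
  rcases i with - | i
  · simp
  · simp only [List.length_cons, Nat.add_lt_add_iff_right] at hi
    have := h ⟨i, hi⟩
    rw [Function.update_of_ne (by push_cast; omega)]
    simp only [List.get_eq_getElem, List.getElem_cons_succ] at this ⊢
    rw [← this]
    congr 1
    push_cast
    ring

lemma within_traceCmd {x : ℤ} {c : ℕ} {σ : Store} (h : S.TraceInv x (c + 1) σ) :
    Within S.w traceCmd σ (8 * S.K) (S.TraceInv x c) := by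
  have hc := h.lt
  obtain ⟨q, v, p, h9, h10, hm, hs, hp⟩ := h.entry
  obtain ⟨q', v', hq', hv', hm', hstep, hadj, hdist⟩ := h.pred c q v hm
  have bs := S.big_adr hc q v
  have bv : S.Big (v' : ℕ) := S.big_natCast (S.fin_le_pow v')
  refine .seq (within_adrCmd (i := c + 1) (q := q) (v := v) h.r7 h9 h10 h.reg_n h.reg_m hc
    (by decide) ?_)
  refine .seq (within_load (a := S.adr (c + 1) q v) (v := (q' : ℕ)) (by simp) (by simp [hq']) bs
    (S.big_natCast (S.state_le_pow q')) ?_)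
  refine .seq (within_load (a := S.adr (c + 1) q v) (v := (v' : ℕ)) (by simp) (by simp [hv']) bs
    bv ?_)
  refine .seq (within_pred (j := c) (by simp [h.r7]) (by simp [h.reg_one])
    (S.layer_le_pow (by omega)) ?_)
  -- The output overwrites the adjacency matrix in bank 0, so `TraceInv` keeps only `Regs` and not
  -- `Ctx`.
  refine .le (T := S.K) (within_store (a := c) (v := (v' : ℕ)) (by simp) (by simp)
    (S.big_natCast (S.layer_le_pow (by omega))) bv ?_)
  exact
  { toRegs := ((((h.toRegs.setReg (by omega) _).setReg (by omega) _).setReg (by omega) _).setReg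
      (by omega) _).setMem ..
    toLayers := by simpa using h.toLayers
    best := by simpa using h.best
    lt := by omega
    r7 := by simp
    entry := by
      refine ⟨q', v', v :: p, by simp, by simp, by simpa using hm',
        by simpa using hs.cons hstep hadj hdist, ?_⟩
      simpa only [Store.mem_setMem, Store.mem_setReg, if_true] using forall_update_get hp }

/-- Nothing has been entered into the tables. -/
structure Ready (S : Setup n m) (σ : Store) : Prop extends Ctx S σ where
  reg6 : σ.reg 6 = 0
  mark : ∀ x, σ.mem 2 x = 0
  dist : ∀ x, σ.mem 3 x = 0

/-- The time for the search. -/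
def searchTime (S : Setup n m) : ℕ :=
  20 * S.K + (S.k + 1) * (S.K + S.layerTime) + (S.d + 1) * (S.K + 24 * S.K) +
    (S.k + 1) * (S.K + 8 * S.K)

lemma Ready.layerInv {σ : Store} (h : S.Ready σ) {τ : Store} (hC : S.Ctx τ)
    (h6 : τ.reg 6 = 0) (h7 : τ.reg 7 = ((S.k - 1 : ℕ) : ℤ))
    (h2 : τ.mem 2 = Function.update (σ.mem 2) (S.adr 0 S.q₀ S.a) 1)
    (h3 : τ.mem 3 = σ.mem 3) : S.LayerInv (S.k - 1) τ := by
  have hk := S.one_le_k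
  have e : S.k - 1 - (S.k - 1) = 0 := by omega
  exact
  { toCtx := hC
    r7 := h7
    lt := by omega
    r6 := by simp [h6]
    layers := by
      rw [e, h2, h3]
      have hm (i q v) : Function.update (σ.mem 2) (S.adr 0 S.q₀ S.a) 1 (S.adr i q v) =
          if i = 0 ∧ q = S.q₀ ∧ v = S.a then 1 else 0 := by
        simp only [Function.update_apply, S.adr_inj, h.mark]
      exact
      { bin := fun i q v => by
          rw [hm]
          split_ifs
          exacts [.inr rfl, .inl rfl]
        start_mark := by simp
        -- The distance 0 of the start entry is never written; it is the initial content of bank 3.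
        start_dist := h.dist _
        start_unique := fun q v hqv => by
          rw [hm] at hqv
          simpa using hqv
        pred := fun i q v hqv => by
          rw [hm] at hqv
          simp at hqv
        relaxed := fun j hj => absurd hj (by omega)
        fresh := fun j q v hj => by
          rw [hm, if_neg (by omega)] } }

/-- The answer in terms of a set-up. -/
def Answer (S : Setup n m) (τ : Store) : Prop := IsAnswer S.G S.wt S.k S.a S.b τ

lemma within_answerCmd (hL : S.M.accepts = distinctWords n S.k) (hs : S.M.start = {S.q₀})
    {σ : Store} (h : S.SelectInv 0 σ) :
    Within S.w answerCmd σ (8 * S.K + (S.k + 1) * (S.K + 8 * S.K)) S.Answer := by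
  have hk := S.one_le_k
  have b21 : S.Big (σ.reg 21) := by
    refine big_bit ?_
    rcases h.selected with h' | h'
    exacts [.inl h'.1, .inr h'.1]
  have bb : S.Big (S.b : ℕ) := S.big_natCast (S.fin_le_pow _)
  -- The search minimizes over transitions. Each final state is witnessed by a listed transition, so
  -- this is also the minimum over final states.
  have hcompl (q : Fin m) (hq : S.Final (σ.mem 2) q) :
      ∃ t, (S.e t).1 = q ∧ S.Completes (σ.mem 2) t := by
    obtain ⟨hm, q', hq', ha⟩ := hq
    obtain ⟨t, ht⟩ := S.exists_e q S.b q' hq'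
    exact ⟨t, by simp [ht], by simp [Completes, ht, hm, ha]⟩
  refine within_branch rfl b21 ?_ ?_
  · intro hpos
    rcases h.selected with h' | ⟨-, q, hq, h23, h22, hbest⟩
    · omega
    refine .seq (within_pred (j := S.k - 1)
      (by rw [h.reg_k, Nat.sub_add_cancel hk]) h.reg_one (S.layer_le_pow (by omega)) ?_)
    refine .seq (within_copy (vx := (q : ℕ)) (by simp [h23]) (by simp [h.reg_zero])
      (S.big_natCast (S.state_le_pow q)) ?_)
    refine .seq (within_copy (vx := (S.b : ℕ)) (by simp [h.reg_b]) (by simp [h.reg_zero]) bb ?_)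
    refine .seq (within_store (a := ((S.k - 1 : ℕ) : ℤ)) (v := (S.b : ℕ)) (by simp) (by simp)
      (S.big_natCast (S.layer_le_pow (by omega))) bb ?_)
    refine .seq ((within_countdown (T := 8 * S.K) (S.TraceInv (σ.reg 22)) (S.k - 1)
      (S.layer_le_pow (by omega)) (fun _ _ h => h.r7) (fun _ _ h => within_traceCmd h) ?_).mono
      (T' := (S.k + 1) * (S.K + 8 * S.K)) (Nat.mul_le_mul_right _ (by omega)) ?_)
    · exact
      { toRegs := (((h.toRegs.setReg (by omega) _).setReg (by omega) _).setReg (by omega) _).setMem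
          ..
        toLayers := by simpa using h.toLayers
        best := fun q' hq' => by
          obtain ⟨t, rfl, ht⟩ := hcompl q' (by simpa using hq')
          simpa using hbest t (Nat.zero_le _) ht
        lt := by omega
        r7 := by simp
        entry := by
          refine ⟨q, S.b, [], by simp, by simp, by simpa using hq.1, ?_, ?_⟩
          · exact
            { length := by simp; omega
              chain := .singleton _
              last := rfl
              accepts := hq.2
              weight := by simp [pathWeight, h22] }
          · simp only [Store.mem_setMem, Store.mem_setReg, if_true]
            exact forall_update_get fun i => i.elim0 }
    · intro τ hτ
      refine .le (T := S.K) (within_const S.big_one ?_)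
      obtain ⟨q, v, p, -, -, hm, hsuf, hp⟩ := hτ.entry
      refine .inl ⟨by simp, v :: p, ?_, ?_⟩
      · exact Layers.isMinSimplePath hτ.toLayers hL hs hτ.best hm hsuf
      · simpa using hp
  · intro hneg
    refine .le (T := S.K) (within_const S.big_zero ?_)
    refine .inr ⟨by simp, ?_⟩
    rcases h.selected with ⟨-, h'⟩ | h'
    · refine Layers.not_exists_isSimplePath h.toLayers hL hs fun q hq => ?_
      obtain ⟨t, -, ht⟩ := hcompl q hq
      exact h' t (Nat.zero_le _) ht
    · omega

lemma within_searchCmd (hL : S.M.accepts = distinctWords n S.k) (hs : S.M.start = {S.q₀})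
    {σ : Store} (h : S.Ready σ) : Within S.w searchCmd σ S.searchTime S.Answer := by
  have hk := S.one_le_k
  unfold searchTime
  have hmul : (S.k - 1 + 1) * (S.K + S.layerTime) ≤ (S.k + 1) * (S.K + S.layerTime) :=
    Nat.mul_le_mul_right _ (by omega)
  refine .seq (within_adrCmd (i := 0) (q := S.q₀) (v := S.a) (by simp [h.reg6]) h.reg_q₀ h.reg_a
    h.reg_n h.reg_m (by omega) (by decide) ?_)
  refine .seq (within_store (a := S.adr 0 S.q₀ S.a) (v := 1) (by simp) (by simp [h.reg_one])
    (S.big_adr (by omega) _ _) S.big_one ?_)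
  refine .seq (within_pred (j := S.k - 1)
    (by simp [h.reg_k]; omega) (by simp [h.reg_one]) (S.layer_le_pow (by omega)) ?_)
  refine .seq ((within_countdown (T := S.layerTime) S.LayerInv (S.k - 1)
    (S.layer_le_pow (by omega)) (fun _ _ h => h.r7) (fun _ _ h => within_layerCmd h) ?_).mono
    hmul ?_)
  · refine h.layerInv (((h.toCtx.setReg (by omega) _).setMem (by omega) _ _).setReg (by omega) _)
      ?_ ?_ ?_ ?_ <;> simp [h.reg6]
  intro τ hτ
  refine .seq (within_const S.big_zero ?_)
  refine .seq (within_copy (vx := S.d) (by simp [hτ.reg_d]) (by simp [hτ.reg_zero])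
    (S.big_natCast (S.transition_le_pow le_rfl)) ?_)
  refine .seq ((within_countdown (T := 24 * S.K) S.SelectInv S.d
    (S.transition_le_pow le_rfl) (fun _ _ h => h.r8) (fun _ _ h => within_selectCmd h) ?_).mono
    (le_refl _) ?_)
  · exact
    { toCtx := (hτ.toCtx.setReg (by omega) _).setReg (by omega) _
      toLayers := by simpa using hτ.layers
      r6 := by simpa using hτ.r6
      r8 := by simp
      le := le_rfl
      selected := .inl ⟨by simp, fun t ht => absurd t.2 (by omega)⟩ }
  · intro υ hυ
    exact .le (within_answerCmd hL hs hυ)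

end Setup
end KPath

/-! ### The input, the running time and the theorem -/

namespace KPath
open WordRAM

lemma sum_sum_pos {n : ℕ} (p : Fin n → Fin n → Prop) [∀ u v, Decidable (p u v)]
    (f : Fin n → Fin n → ℤ) (u v : Fin n) :
    (∑ u' : Fin n, ∑ v' : Fin n,
      if ((u : ℕ) * (n : ℤ) + (v : ℕ)) = (u' : ℕ) * (n : ℤ) + (v' : ℕ) ∧ p u' v'
        then f u' v' else 0) = if p u v then f u v else 0 := by
  have e (u' v' : Fin n) (h : (u : ℕ) * (n : ℤ) + (v : ℕ) = (u' : ℕ) * (n : ℤ) + (v' : ℕ)) :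
      u' = u ∧ v' = v := by
    obtain ⟨h₁, h₂⟩ := add_mul_inj h
    exact ⟨Fin.ext (by omega), h₂.symm⟩
  rw [Finset.sum_eq_single u, Finset.sum_eq_single v]
  · simp
  · intro v' _ hv
    rw [if_neg]
    exact fun h => hv (e _ _ h.1).2
  · simp
  · intro u' _ hu
    refine Finset.sum_eq_zero fun v' _ => if_neg ?_
    exact fun h => hu (e _ _ h.1).1
  · simp

/-- Every symbol begins some word of `L_k(n)`: append `k - 1` of the others. Hence every symbol
labels a transition, which bounds `n` by the size of the automaton and so by `2 ^ w`. -/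
lemma exists_mem_step {n k : ℕ} {σ : Type*} {M : NFA (Fin n) σ} {q₀ : σ} (hk : 1 ≤ k)
    (hkn : k ≤ n) (hL : M.accepts = distinctWords n k) (hs : M.start = {q₀}) (v : Fin n) :
    ∃ q, q ∈ M.step q₀ v := by
  have hmem : v :: ((List.finRange n).erase v).take (k - 1) ∈ distinctWords n k := by
    have hn := List.nodup_finRange n
    constructor
    · simp only [List.length_cons, List.length_take,
        List.length_erase_of_mem (List.mem_finRange v), List.length_finRange]
      omega
    · refine List.nodup_cons.2 ⟨fun h => ?_, (hn.erase v).sublist (List.take_sublist _ _)⟩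
      exact hn.not_mem_erase (List.mem_of_mem_take h)
  rw [← hL, mem_accepts_iff_acceptsFrom hs] at hmem
  obtain ⟨q, hq, -⟩ := hmem
  exact ⟨q, hq⟩

lemma autSize_eq {n m d : ℕ} {M : NFA (Fin n) (Fin m)} (e : Fin d ≃ transitions M) :
    autSize M = m + d := by
  have : (transitions M).ncard = d := by
    rw [← Nat.card_coe_set_eq, ← Nat.card_congr e, Nat.card_fin]
  rw [autSize, this, Nat.card_fin]

namespace Setup

variable {n m : ℕ} (S : Setup n m)

/-- With `n + 1` and `k + 1` at most `2 * n`, a transition costs at most `12 + 42 = 54` units of `K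
* n` and a layer at most `4 + 55 = 59` units of `K * s * n`. The total is `20 + 120 + 25 + 18 =
183`. -/
lemma searchTime_le :
    S.searchTime ≤ 183 * (S.K * (m + S.d) * n ^ 2) := by
  have hk := S.one_le_k
  have hkn := S.k_le
  have hm : 1 ≤ m := S.q₀.pos
  have hn1 : 1 ≤ n := hk.trans hkn
  set s := m + S.d with hs
  have hs1 : 1 ≤ s := by omega
  have hds : S.d + 1 ≤ s := by omega
  have h₁ : S.transitionTime ≤ 54 * (S.K * n) := by
    have : S.K * 1 ≤ S.K * n := Nat.mul_le_mul_left _ hn1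
    unfold transitionTime vertexTime
    nlinarith
  have h₂ : S.layerTime ≤ 59 * (S.K * s * n) := by
    have a₁ : S.K * 1 ≤ S.K * n := Nat.mul_le_mul_left _ hn1
    have a₂ : S.K * n * 1 ≤ S.K * n * s := Nat.mul_le_mul_left _ hs1
    have a₃ : (S.d + 1) * (S.K + S.transitionTime) ≤ s * (55 * (S.K * n)) :=
      Nat.mul_le_mul hds (by omega)
    unfold layerTime
    nlinarith
  have b₁ : S.K * 1 ≤ S.K * n := Nat.mul_le_mul_left _ hn1
  have b₂ : S.K * n * 1 ≤ S.K * n * s := Nat.mul_le_mul_left _ hs1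
  have b₃ : S.K * n * s * 1 ≤ S.K * n * s * n := Nat.mul_le_mul_left _ hn1
  have b₄ : S.K * s * 1 ≤ S.K * s * n := Nat.mul_le_mul_left _ hn1
  have c₁ : (S.k + 1) * (S.K + S.layerTime) ≤ (2 * n) * (60 * (S.K * s * n)) :=
    Nat.mul_le_mul (by omega) (by nlinarith)
  have c₂ : (S.d + 1) * (S.K + 24 * S.K) ≤ s * (S.K + 24 * S.K) := Nat.mul_le_mul_right _ hds
  have c₃ : (S.k + 1) * (S.K + 8 * S.K) ≤ (2 * n) * (S.K + 8 * S.K) :=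
    Nat.mul_le_mul_right _ (by omega)
  unfold searchTime
  nlinarith

/-- `K` is at most `15 + 3 * Nat.log 2 W`. Because `W ≥ 2`, the constant is absorbed, and `18 / log
2 < 27`. -/
lemma K_le_log (hW : 2 ≤ S.W) : (S.K : ℝ) ≤ 27 * Real.log S.W := by
  have h2 := Real.log_two_gt_d9
  have h₁ : Nat.size S.W ≤ Nat.log 2 S.W + 1 :=
    Nat.size_le.2 (Nat.lt_pow_succ_log_self (by norm_num) _)
  have h₂ : (Nat.log 2 S.W : ℝ) * Real.log 2 ≤ Real.log S.W := by
    rw [← Real.log_pow]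
    refine Real.log_le_log (by positivity) ?_
    exact_mod_cast Nat.pow_log_le_self 2 (by omega)
  have h₃ : Real.log 2 ≤ Real.log S.W :=
    Real.log_le_log (by norm_num) (by exact_mod_cast hW)
  have h₄ : (S.K : ℝ) ≤ 3 * (5 + Nat.log 2 S.W) := by
    have : S.K ≤ 3 * (5 + Nat.log 2 S.W) := by
      unfold K
      omega
    exact_mod_cast this
  have h₅ : (0 : ℝ) ≤ Nat.log 2 S.W := by positivity
  nlinarith

end Setup

theorem solvesWithin_solveCmd (P : Cmd) (C : ℝ) {n k m w : ℕ} (M : NFA (Fin n) (Fin m))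
    (hk : 1 ≤ k) (hkn : k ≤ n) (hL : M.accepts = distinctWords n k)
    (hw : Nat.size (autSize M) ≤ w) (hP : ConstructsWithin w P k M (C * autSize M))
    (G : Digraph (Fin n)) (wt : Fin n → Fin n → ℤ) (a b : Fin n) (W : ℕ) (hW : 2 ≤ W)
    (hwt : ∀ u v, G.Adj u v → -(W : ℤ) ≤ wt u v ∧ wt u v ≤ W) :
    2 ≤ autSize M ∧ SolvesWithin w (Setup.solveCmd P) G wt k a b
      ((2 * |C| + 5022) * (autSize M * (n : ℝ) ^ 2 * Real.log W)) := by
  classical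
  obtain ⟨τ, t, hex, ⟨q₀, d, e, hs, h0, h1, h2, htr, hacc⟩, ht⟩ := hP
  have hsize := autSize_eq e
  have hlt : autSize M < 2 ^ w := Nat.size_le.1 hw
  -- Choosing for each symbol a transition out of the start state shows that the labels exhaust
  -- `[n]`.
  have hnd : n ≤ d := by
    have hsurj : Function.Surjective fun i : Fin d => (e i).1.2.1 := by
      intro v
      obtain ⟨q, hq⟩ := exists_mem_step hk hkn hL hs v
      exact ⟨e.symm ⟨(q₀, v, q), hq⟩, by simp⟩
    simpa using Fintype.card_le_of_surjective _ hsurj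
  have hm : 1 ≤ m := q₀.pos
  let S : Setup n m :=
    { G, wt, k, a, b, M, q₀, d, W, w
      e := fun i => (e i).1
      one_le_k := hk
      k_le := hkn
      one_le_W := by omega
      one_le_w := by
        by_contra hw0
        obtain rfl : w = 0 := by omega
        omega
      n_lt := by omega
      m_lt := by omega
      d_lt := by omega
      mem_e := fun i => (e i).2
      exists_e := fun q v q' h => ⟨e.symm ⟨(q, v, q'), h⟩, by simp⟩
      abs_wt := fun u v h => abs_le.2 (hwt u v h) }
  let σ := (((pathInput G wt k a b).setReg 5 1).setReg 32 n).setReg 33 k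
  -- Once `n` and `k` are copied to registers 32 and 33, the relocated `P` sees exactly its own
  -- input, since the path instance leaves everything else there at 0.
  have hview : σ.view 32 8 = paramInput n k := by
    simp only [Store.view, paramInput, Store.mk.injEq]
    constructor
    · funext r
      rcases r with - | - | r <;> simp [σ, pathInput]
    · funext b x
      simp [σ, pathInput]
  obtain ⟨τ', hex', hv, hreg, hmem⟩ := hex.shift 32 8 σ hview
  have hvr (r : ℕ) : τ'.reg (r + 32) = τ.reg r := by rw [← hv]; rfl
  have hvm (b : ℕ) : τ'.mem (b + 8) = τ.mem b := by rw [← hv]; rfl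
  have hready : S.Ready τ' :=
    { reg_n := by rw [hreg _ (by omega)]; simp [σ, pathInput]
      reg_k := by rw [hreg _ (by omega)]; simp [σ, pathInput, S]
      reg_a := by rw [hreg _ (by omega)]; simp [σ, pathInput, S]
      reg_b := by rw [hreg _ (by omega)]; simp [σ, pathInput, S]
      reg_zero := by rw [hreg _ (by omega)]; simp [σ, pathInput]
      reg_one := by rw [hreg _ (by omega)]; simp [σ]
      reg_m := (hvr 0).trans h0
      reg_d := (hvr 1).trans h1
      reg_q₀ := (hvr 2).trans h2
      adj := by
        intro u v
        have : τ'.mem 0 (S.pos u v) = if G.Adj u v then 1 else 0 := by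
          rw [hmem _ (by omega)]
          exact sum_sum_pos G.Adj (fun _ _ => 1) u v
        rw [this]
        by_cases h : G.Adj u v
        · exact .inl ⟨if_pos h, h⟩
        · exact .inr ⟨if_neg h, h⟩
      wt := by
        intro u v h
        have : τ'.mem 1 (S.pos u v) = if G.Adj u v then wt u v else 0 := by
          rw [hmem _ (by omega)]
          exact sum_sum_pos G.Adj wt u v
        rw [this, if_pos h]
      src := fun i => by rw [hvm 0]; exact (htr i).1
      lab := fun i => by rw [hvm 1]; exact (htr i).2.1
      tgt := fun i => by rw [hvm 2]; exact (htr i).2.2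
      acc := fun q => by
        rw [hvm 3, hacc q]
        by_cases h : q ∈ M.accept
        · exact .inl ⟨if_pos h, h⟩
        · exact .inr ⟨if_neg h, h⟩
      reg6 := by rw [hreg _ (by omega)]; simp [σ, pathInput]
      mark := fun x => by rw [hmem _ (by omega)]; simp [σ, pathInput]
      dist := fun x => by rw [hmem _ (by omega)]; simp [σ, pathInput] }
  have hrun : Within w (Setup.solveCmd P) (pathInput G wt k a b) (3 * S.K + t + S.searchTime)
      S.Answer := by
    refine .seq (Setup.within_const (S := S) S.big_one ?_)
    refine .seq (Setup.within_copy (S := S) (vx := n) (by simp [pathInput]) (by simp [pathInput])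
      (S.big_natCast (S.nat_le_pow le_rfl)) ?_)
    refine .seq (Setup.within_copy (S := S) (vx := k) (by simp [pathInput]) (by simp [pathInput])
      (S.big_natCast (S.nat_le_pow hkn)) ?_)
    refine .seq ⟨τ', t, hex', le_rfl, ?_⟩
    exact .le (Setup.within_searchCmd (S := S) hL hs hready)
  obtain ⟨υ, t', hex'', ht', hans⟩ := hrun
  refine ⟨by omega, υ, t', hex'', hans, ?_⟩
  have hn1 : 1 ≤ n := hk.trans hkn
  -- Three preparatory instructions raise 183 to 186, and `186 * 27 = 5022`.
  have htime : t' ≤ t + 186 * (S.K * autSize M * n ^ 2) := by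
    have h₁ := S.searchTime_le
    have h₂ : S.K * 1 ≤ S.K * (autSize M * n ^ 2) :=
      Nat.mul_le_mul_left _ (Nat.mul_pos (by omega) (by positivity))
    have h₃ : m + S.d = autSize M := hsize.symm
    rw [h₃] at h₁
    rw [← mul_assoc] at h₂
    omega
  have htime' : (t' : ℝ) ≤ t + 186 * (S.K * autSize M * (n : ℝ) ^ 2) := by exact_mod_cast htime
  have hKlog : (S.K : ℝ) ≤ 27 * Real.log W := S.K_le_log hW
  have hlogW : 1 / 2 ≤ Real.log W := by
    have h2 := Real.log_two_gt_d9
    have := Real.log_le_log (x := 2) (y := W) (by norm_num) (by exact_mod_cast hW)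
    linarith
  have hn2 : (1 : ℝ) ≤ (n : ℝ) ^ 2 := one_le_pow₀ (by exact_mod_cast hn1)
  have hsz : (0 : ℝ) ≤ autSize M := by positivity
  have hmul : (S.K : ℝ) * (autSize M * (n : ℝ) ^ 2) ≤
      27 * Real.log W * (autSize M * (n : ℝ) ^ 2) :=
    mul_le_mul_of_nonneg_right hKlog (by positivity)
  -- This absorbs the running time of `P`, which carries no factor `n ^ 2 * log W`; it yields the
  -- term `2 * |C|`.
  have hone : (1 : ℝ) ≤ 2 * ((n : ℝ) ^ 2 * Real.log W) := by nlinarith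
  have hC : C * autSize M ≤ |C| * autSize M * (2 * ((n : ℝ) ^ 2 * Real.log W)) :=
    (mul_le_mul_of_nonneg_right (le_abs_self C) hsz).trans
      (le_mul_of_one_le_right (by positivity) hone)
  calc (t' : ℝ) ≤ C * autSize M + 186 * (S.K * (autSize M * (n : ℝ) ^ 2)) := by linarith
    _ ≤ |C| * autSize M * (2 * ((n : ℝ) ^ 2 * Real.log W)) +
        186 * (27 * Real.log W * (autSize M * (n : ℝ) ^ 2)) := by linarith
    _ = _ := by ring

end KPath

theorem theorem1 (P : WordRAM.Cmd) :
    (∃ A : WordRAM.Cmd, ∀ C : ℝ, ∃ D : ℝ,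
      ∀ (n k m w : ℕ) (M : NFA (Fin n) (Fin m)),
        1 ≤ k → k ≤ n →
        M.accepts = KPath.distinctWords n k →
        Nat.size (KPath.autSize M) ≤ w →
        KPath.ConstructsWithin w P k M (C * KPath.autSize M) →
        ∀ (G : Digraph (Fin n)) (wt : Fin n → Fin n → ℤ) (a b : Fin n) (W : ℕ),
          2 ≤ W →
          (∀ u v, G.Adj u v → 0 ≤ wt u v ∧ wt u v ≤ W) →
          KPath.SolvesWithin w A G wt k a b
            (D * (KPath.autSize M * Real.log (KPath.autSize M) * (n : ℝ) ^ 2 * Real.log W))) ∧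
    (∃ A : WordRAM.Cmd, ∀ C : ℝ, ∃ D : ℝ,
      ∀ (n k m w : ℕ) (M : NFA (Fin n) (Fin m)),
        1 ≤ k → k ≤ n →
        M.accepts = KPath.distinctWords n k →
        KPath.IsAcyclic M →
        Nat.size (KPath.autSize M) ≤ w →
        KPath.ConstructsWithin w P k M (C * KPath.autSize M) →
        ∀ (G : Digraph (Fin n)) (wt : Fin n → Fin n → ℤ) (a b : Fin n) (W : ℕ),
          2 ≤ W →
          (∀ u v, G.Adj u v → -(W : ℤ) ≤ wt u v ∧ wt u v ≤ W) →
          KPath.SolvesWithin w A G wt k a b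
            (D * (KPath.autSize M * (n : ℝ) ^ 2 * Real.log W))) := by
  refine ⟨⟨KPath.Setup.solveCmd P, fun C => ⟨2 * (2 * |C| + 5022), ?_⟩⟩,
    ⟨KPath.Setup.solveCmd P, fun C => ⟨2 * |C| + 5022, ?_⟩⟩⟩
  · intro n k m w M hk hkn hL hw hP G wt a b W hW hwt
    obtain ⟨hsize, υ, t, hex, hans, ht⟩ := KPath.solvesWithin_solveCmd P C M hk hkn hL hw hP G wt
      a b W hW fun u v h => ⟨by have := (hwt u v h).1; omega, (hwt u v h).2⟩
    refine ⟨υ, t, hex, hans, ht.trans ?_⟩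
    have hlogW : 0 ≤ Real.log W := Real.log_natCast_nonneg W
    -- The automaton has a state and a transition, so `log σ ≥ log 2 > 1 / 2`. This explains the
    -- additional factor 2 in the first constant.
    have hlog : 1 ≤ 2 * Real.log (KPath.autSize M) := by
      have h2 := Real.log_two_gt_d9
      have := Real.log_le_log (x := 2) (y := KPath.autSize M) (by norm_num)
        (by exact_mod_cast hsize)
      linarith
    calc (2 * |C| + 5022) * (KPath.autSize M * (n : ℝ) ^ 2 * Real.log W)
        ≤ (2 * |C| + 5022) * (KPath.autSize M * (n : ℝ) ^ 2 * Real.log W) *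
            (2 * Real.log (KPath.autSize M)) := le_mul_of_one_le_right (by positivity) hlog
      _ = _ := by ring
  · intro n k m w M hk hkn hL _ hw hP G wt a b W hW hwt
    exact (KPath.solvesWithin_solveCmd P C M hk hkn hL hw hP G wt a b W hW hwt).2
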